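/- Let $n\ge 2$, let $\alpha=(\alpha_1,\dots,\alpha_n)$ with $\alpha_k\in(-\pi,\pi)\setminus\{0\}$, and put $$K_\alpha(x,\xi)=\prod_{k=1}^n C_{\alpha_k}\,e^{i\left(\frac{x_k^2+\xi_k^2}{2}\cot\alpha_k-x_k\xi_k\csc\alpha_k\right)},\qquad C_{\alpha_k}=\sqrt{\frac{1-i\cot\alpha_k}{2\pi}}\quad\text{(principal root)}.$$ The fractional Fourier transform is $\mathcal F_\alpha\varphi(\xi)=\int_{\mathbb R^n}\varphi(x)K_\alpha(x,\xi)\,dx$ for $\varphi\in\mathcal S(\mathbb R^n)$ and $\langle\mathcal F_\alpha f,\varphi\rangle=\langle f,\mathcal F_\alpha\varphi\rangle$ for $f\in\mathcal S'(\mathbb R^n)$; the product of $f\in\mathcal S'(\mathbb R^n)$ with a smooth function $g$ all of whose derivatives have at most polynomial growth is $\langle fg,\varphi\rangle=\langle f,g\varphi\rangle$. Dual spaces carry the strong topology, $du$ is the normalized surface measure of $\mathbb S^{n-1}$, and $\langle\cdot,\cdot\rangle$ is the bilinear dual pairing. Let $\mathbb Y^{2n}=\mathbb S^{n-1}\times\mathbb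 R\times\mathbb R^n$ and let $\mathcal S(\mathbb Y^{2n})$ be the space of all $\Phi\in C^\infty(\mathbb Y^{2n})$ with $$\sup_{(u,b,a)}(1+|b|^2)^{r/2}(1+|a|^2)^{s/2}\,|\partial_a^l\partial_b^m\Delta_u^k\Phi(u,b,a)|<\infty\qquad(r,s,m,k\in\mathbb N_0,\ l\in\mathbb N_0^n),$$ where $\Delta_u$ is the Laplace–Beltrami operator of $\mathbb S^{n-1}$, with the topology of these seminorms; $\mathcal S'(\mathbb Y^{2n})$ is its dual. For $\psi\in\mathcal S(\mathbb R)$ and $\Phi\in\mathcal S(\mathbb Y^{2n})$ put $$(DS^\alpha_\psi)^*\Phi(x)=\int_{\mathbb S^{n-1}}\int_{\mathbb R^n}\int_{\mathbb R}\Phi(u,b,a)\,\psi(x\cdot u-b)\,K_{-\alpha}(x,a)\,db\,da\,du .$$ For $f\in\mathcal S'(\mathbb R^n)$ the directional short-time fractional Fourier transform $DS^\alpha_\psi f\in\mathcal S'(\mathbb Y^{2n})$ is defined by $\langle DS^\alpha_\psi f,\Phi\rangle=\big\langle f,\overline{(DS^\alpha_\psi)^*(\overline\Phi)}\big\rangle$.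 **Proposition.** Let $f\in\mathcal S'(\mathbb R^n)$ and $\psi\in\mathcal S(\mathbb R)$. Then $DS^\alpha_\psi f$ is a well-defined element of $\mathcal S'(\mathbb Y^{2n})$ (that is, $\overline{(DS^\alpha_\psi)^*(\overline\Phi)}\in\mathcal S(\mathbb R^n)$ for every $\Phi\in\mathcal S(\mathbb Y^{2n})$, and the functional so defined is linear and continuous), and, with $F(u,b)=\mathcal F_\alpha\big(f(\cdot)\,\overline{\psi}((\cdot)\cdot u-b)\big)\in\mathcal S'(\mathbb R^n)$, $$\langle DS^\alpha_\psi f,\Phi\rangle=\int_{\mathbb S^{n-1}}\int_{\mathbb R}\langle F(u,b),\Phi(u,b,\cdot)\rangle\,db\,du,\qquad\Phi\in\mathcal S(\mathbb Y^{2n}),$$ where the integral is absolutely convergent; thus $DS^\alpha_\psi f$ is given by the $\mathcal S'(\mathbb R^n)$-valued function $F$ on $\mathbb S^{n-1}\times\mathbb R$. Furthermore $F\in C^\infty(\mathbb S^{n-1}\times\mathbb R,\mathcal S'(\mathbb R^n))$, and $F$ is of slow growth: there is $s\in\mathbb N_0$ such that for every continuous seminorm $p$ on $\mathcal S'(\mathbb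 R^n)$ there is $C>0$ with $p(F(u,b))\le C(1+|b|)^s$ for all $(u,b)\in\mathbb S^{n-1}\times\mathbb R$. -/

import Mathlib

open Set Filter Topology MeasureTheory
open scoped SchwartzMap ContDiff Manifold FourierTransform ComplexConjugate InnerProductSpace Laplacian

-- A duplicate of the standard chart structures, switched off so that it is never picked.
attribute [-instance] TopCat.of.chartedSpace

noncomputable section

namespace DSTFRFT

/-! Throughout `n = d + 1`, so that the unit sphere of `ℝⁿ` is a `d`-dimensional manifold. -/

/-- The Euclidean space `ℝⁿ`, `n = d + 1`. -/
abbrev Rn (d : ℕ) : Type := EuclideanSpace ℝ (Fin (d + 1))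

/-- The unit sphere of `ℝⁿ`, `n = d + 1`. -/
abbrev Sph (d : ℕ) : Type := Metric.sphere (0 : Rn d) 1

/-- The manifold `𝕐²ⁿ = 𝕊ⁿ⁻¹ × ℝ × ℝⁿ`; its points are `(u, b, a)`. -/
abbrev Y (d : ℕ) : Type := Sph d × ℝ × Rn d

/-- The space of tempered distributions on `ℝⁿ` with the strong dual topology
(uniform convergence on the bounded sets of `𝓢(ℝⁿ)`). -/
abbrev TD (d : ℕ) : Type := StrongDual ℂ (𝓢(Rn d, ℂ))

/-- The normalized surface measure of the unit sphere. -/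
def sphereMeasure (d : ℕ) : Measure (Sph d) :=
  ((volume : Measure (Rn d)).toSphere univ)⁻¹ • (volume : Measure (Rn d)).toSphere

instance (d : ℕ) : IsProbabilityMeasure (sphereMeasure d) := by
  have h0 : (volume : Measure (Rn d)).toSphere univ ≠ 0 := by
    rw [Measure.measure_univ_ne_zero, Ne, Measure.toSphere_eq_zero_iff_finrank]
    simp
  constructor
  rw [sphereMeasure, Measure.smul_apply, smul_eq_mul]
  exact ENNReal.inv_mul_cancel h0 (measure_ne_top _ _)

/-! ### The fractional Fourier transform -/

/-- The constant `C_θ = √((1 - i cot θ) / (2π))` (principal square root). -/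
def fracConst (θ : ℝ) : ℂ :=
  ((1 - Complex.I * (Real.cot θ : ℂ)) / (2 * Real.pi : ℂ)) ^ (1 / 2 : ℂ)

/-- The one-dimensional kernel
`K_θ(x, ξ) = C_θ exp(i ((x² + ξ²)/2 cot θ - x ξ csc θ))` for `θ ∉ π ℤ`. -/
def fracKernel₁ (θ x ξ : ℝ) : ℂ :=
  fracConst θ * Complex.exp
    (Complex.I * (((x ^ 2 + ξ ^ 2) / 2 * Real.cot θ - x * ξ * (Real.sin θ)⁻¹ : ℝ) : ℂ))

/-- The `n`-dimensional kernel `K_α(x, ξ) = ∏ₖ K_{αₖ}(xₖ, ξₖ)`. -/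
def fracKernel {d : ℕ} (α : Fin (d + 1) → ℝ) (x ξ : Rn d) : ℂ :=
  ∏ k, fracKernel₁ (α k) (x k) (ξ k)

/-- The chirp `x ↦ exp((i/2) ∑ₖ xₖ² cot αₖ)`. -/
def chirp {d : ℕ} (α : Fin (d + 1) → ℝ) (x : Rn d) : ℂ :=
  Complex.exp (((∑ k, x k ^ 2 / 2 * Real.cot (α k) : ℝ) : ℂ) * Complex.I)

theorem hasTemperateGrowth_expI :
    Function.HasTemperateGrowth (fun t : ℝ => Complex.exp ((t : ℂ) * Complex.I)) := by
  have hd : ∀ t : ℝ, HasDerivAt (fun t : ℝ => Complex.exp ((t : ℂ) * Complex.I))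
      (Complex.exp ((t : ℂ) * Complex.I) * Complex.I) t := fun t => by
    have := ((Complex.ofRealCLM.hasDerivAt (x := t)).mul_const Complex.I).cexp
    simpa using this
  refine ⟨?_, fun n => ⟨0, 1, fun t => ?_⟩⟩
  · exact Complex.contDiff_exp.comp (Complex.ofRealCLM.contDiff.mul contDiff_const)
  · have key : ∀ n : ℕ, iteratedDeriv n (fun t : ℝ => Complex.exp ((t : ℂ) * Complex.I))
        = fun t : ℝ => Complex.exp ((t : ℂ) * Complex.I) * Complex.I ^ n := by
      intro n
      induction n with
      | zero => simp
      | succ k ih =>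
        rw [iteratedDeriv_succ, ih]
        funext t
        rw [((hd t).mul_const _).deriv, pow_succ']
        ring
    rw [norm_iteratedFDeriv_eq_norm_iteratedDeriv, key]
    simp [Complex.norm_exp_ofReal_mul_I]

theorem hasTemperateGrowth_coord {d : ℕ} (k : Fin (d + 1)) :
    Function.HasTemperateGrowth (fun x : Rn d => x k) :=
  (EuclideanSpace.proj k : Rn d →L[ℝ] ℝ).hasTemperateGrowth

theorem hasTemperateGrowth_chirp {d : ℕ} (α : Fin (d + 1) → ℝ) :
    Function.HasTemperateGrowth (chirp α) := by
  refine hasTemperateGrowth_expI.comp (f := fun x : Rn d => ∑ k, x k ^ 2 / 2 * Real.cot (α k)) ?_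
  refine Function.HasTemperateGrowth.sum fun k _ => ?_
  simp only [div_eq_mul_inv]
  exact (((hasTemperateGrowth_coord k).pow 2).mul (.const _)).mul (.const _)

/-- The dilation `ξ ↦ (ξₖ csc αₖ / (2π))ₖ`. -/
def dilation {d : ℕ} (α : Fin (d + 1) → ℝ) (hα : ∀ k, Real.sin (α k) ≠ 0) : Rn d ≃L[ℝ] Rn d :=
  (EuclideanSpace.equiv (Fin (d + 1)) ℝ).trans
    ((ContinuousLinearEquiv.piCongrRight fun k =>
      ContinuousLinearEquiv.unitsEquivAut ℝ (Units.mk0 ((Real.sin (α k))⁻¹ / (2 * Real.pi))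
        (div_ne_zero (inv_ne_zero (hα k)) Real.two_pi_pos.ne'))).trans
      (EuclideanSpace.equiv (Fin (d + 1)) ℝ).symm)

theorem dilation_apply {d : ℕ} (α : Fin (d + 1) → ℝ) (hα : ∀ k, Real.sin (α k) ≠ 0)
    (ξ : Rn d) (k : Fin (d + 1)) :
    dilation α hα ξ k = ξ k * ((Real.sin (α k))⁻¹ / (2 * Real.pi)) := by
  simp [dilation]

/-- The fractional Fourier transform of order `α` (no `αₖ` in `π ℤ`) as a continuous operator
on `𝓢(ℝⁿ)`; it is given by the integral against the kernel `K_α`, see `frft_apply`. -/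
def frft {d : ℕ} (α : Fin (d + 1) → ℝ) (hα : ∀ k, Real.sin (α k) ≠ 0) :
    𝓢(Rn d, ℂ) →L[ℂ] 𝓢(Rn d, ℂ) :=
  (∏ k, fracConst (α k)) •
    ((SchwartzMap.smulLeftCLM ℂ (chirp α)) ∘L
      (SchwartzMap.compCLMOfContinuousLinearEquiv ℂ (dilation α hα)) ∘L
      (FourierTransform.fourierCLM ℂ 𝓢(Rn d, ℂ)) ∘L
      (SchwartzMap.smulLeftCLM ℂ (chirp α)))

/-- `(𝓕_α φ)(ξ) = ∫ φ(x) K_α(x, ξ) dx`. -/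
theorem frft_apply {d : ℕ} (α : Fin (d + 1) → ℝ) (hα : ∀ k, Real.sin (α k) ≠ 0)
    (φ : 𝓢(Rn d, ℂ)) (ξ : Rn d) :
    frft α hα φ ξ = ∫ x, φ x * fracKernel α x ξ := by
  have h1 : frft α hα φ ξ = (∏ k, fracConst (α k)) * (chirp α ξ *
      𝓕 (fun x => chirp α x * φ x) (dilation α hα ξ)) := by
    have hc := hasTemperateGrowth_chirp α
    have e : (⇑(SchwartzMap.smulLeftCLM ℂ (chirp α) φ) : Rn d → ℂ) = fun x => chirp α x * φ x := by
      funext x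
      simp [SchwartzMap.smulLeftCLM_apply_apply hc]
    simp [frft, SchwartzMap.smulLeftCLM_apply_apply hc, SchwartzMap.fourier_coe, e]
  rw [h1, Real.fourier_eq', ← integral_const_mul, ← integral_const_mul]
  refine integral_congr_ae (Eventually.of_forall fun x => ?_)
  simp only [fracKernel, fracKernel₁, Finset.prod_mul_distrib, ← Complex.exp_sum, chirp, smul_eq_mul]
  have h2 : ∀ A B C D E P φ : ℂ, A = B + C + D → E = Complex.exp A →
      P * (Complex.exp B * (Complex.exp C * (Complex.exp D * φ))) = φ * (P * E) := by
    intro A B C D E P φ hA hE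
    rw [hE, hA, Complex.exp_add, Complex.exp_add]; ring
  rw [← h2 _ _ _ _ _ _ _ ?_ rfl]
  rw [PiLp.inner_apply]
  simp only [dilation_apply, RCLike.inner_apply, conj_trivial]
  push_cast
  rw [Finset.sum_mul, Finset.sum_mul, Finset.mul_sum, Finset.sum_mul, ← Finset.sum_add_distrib,
    ← Finset.sum_add_distrib]
  refine Finset.sum_congr rfl fun k _ => ?_
  have : (Real.pi : ℂ) ≠ 0 := by exact_mod_cast Real.pi_ne_zero
  field_simp
  ring

/-- The fractional Fourier transform of a tempered distribution:
`⟨𝓕_α f, φ⟩ = ⟨f, 𝓕_α φ⟩`. -/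
def frftTD {d : ℕ} (α : Fin (d + 1) → ℝ) (hα : ∀ k, Real.sin (α k) ≠ 0) (f : TD d) : TD d :=
  f ∘L frft α hα

/-! ### Windows -/

/-- The directional window `x ↦ ψ̄(x · u - b)`. -/
def window {d : ℕ} (ψ : 𝓢(ℝ, ℂ)) (u : Sph d) (b : ℝ) (x : Rn d) : ℂ :=
  conj (ψ (⟪x, (u : Rn d)⟫_ℝ - b))

theorem hasTemperateGrowth_window {d : ℕ} (ψ : 𝓢(ℝ, ℂ)) (u : Sph d) (b : ℝ) :
    Function.HasTemperateGrowth (window ψ u b) := by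
  have h1 : Function.HasTemperateGrowth (fun x : Rn d => ⟪x, (u : Rn d)⟫_ℝ - b) :=
    (Function.hasTemperateGrowth_inner_left (u : Rn d)).sub (.const b)
  have h2 := ψ.hasTemperateGrowth.comp h1
  exact (Complex.conjCLE.toContinuousLinearMap.hasTemperateGrowth).comp h2

/-- The product `f · ψ̄(· · u - b)`, that is `⟨f · ψ̄(· · u - b), φ⟩ = ⟨f, ψ̄(· · u - b) φ⟩`. -/
def mulWindow {d : ℕ} (ψ : 𝓢(ℝ, ℂ)) (u : Sph d) (b : ℝ) (f : TD d) : TD d :=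
  f ∘L SchwartzMap.smulLeftCLM ℂ (window ψ u b)

theorem mulWindow_test {d : ℕ} (ψ : 𝓢(ℝ, ℂ)) (u : Sph d) (b : ℝ) (φ : 𝓢(Rn d, ℂ)) (x : Rn d) :
    SchwartzMap.smulLeftCLM ℂ (window ψ u b) φ x = window ψ u b x * φ x := by
  simp [SchwartzMap.smulLeftCLM_apply_apply (hasTemperateGrowth_window ψ u b)]

theorem sin_ne_zero_of_mem {d : ℕ} {α : Fin (d + 1) → ℝ}
    (hα : ∀ k, α k ∈ Ioo (-Real.pi) Real.pi \ {0}) (k : Fin (d + 1)) : Real.sin (α k) ≠ 0 := by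
  obtain ⟨⟨h1, h2⟩, h3⟩ := hα k
  exact fun h => h3 ((Real.sin_eq_zero_iff_of_lt_of_lt h1 h2).1 h)

/-! ### The space `𝓢(𝕐²ⁿ)` -/

/-- The function `x ↦ g(x / |x|)` on `ℝⁿ ∖ {0}` (extended by `0` to the origin). -/
def radialExt {d : ℕ} (g : Sph d → ℂ) (x : Rn d) : ℂ :=
  if h : x ≠ 0 then g ⟨‖x‖⁻¹ • x, by simp [norm_smul, h]⟩ else 0

/-- The Laplace-Beltrami operator of the unit sphere: the Euclidean Laplacian of the extension
that is homogeneous of degree `0`, restricted to the sphere. -/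
def sphereLaplacian {d : ℕ} (g : Sph d → ℂ) (u : Sph d) : ℂ :=
  (Δ (radialExt g)) (u : Rn d)

/-- The Laplace-Beltrami operator `Δ_u` in the variable `u`. -/
def lapU {d : ℕ} (Φ : Y d → ℂ) (y : Y d) : ℂ :=
  sphereLaplacian (fun u => Φ (u, y.2)) y.1

/-- Smooth functions on the manifold `𝕐²ⁿ`. -/
def SmoothY {d : ℕ} (Φ : Y d → ℂ) : Prop :=
  ContMDiff ((𝓡 d).prod (𝓘(ℝ, ℝ).prod 𝓘(ℝ, Rn d))) 𝓘(ℝ, ℂ) ∞ Φ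

/-- The total derivative of order `l` in `a` (all partial derivatives `∂_a^λ`, `|λ| = l`) of
`∂_b^m Δ_u^k Φ`. -/
def diffY {d : ℕ} (k m l : ℕ) (Φ : Y d → ℂ) (y : Y d) :
    ContinuousMultilinearMap ℝ (fun _ : Fin l => Rn d) ℂ :=
  iteratedFDeriv ℝ l
    (fun a => iteratedDeriv m (fun b => (lapU^[k] Φ) (y.1, b, a)) y.2.1) y.2.2

/-- The weight `(1 + |b|²)^(r/2) (1 + |a|²)^(s/2)`. -/
def weight {d : ℕ} (r s : ℕ) (y : Y d) : ℝ :=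
  (1 + |y.2.1| ^ 2) ^ ((r : ℝ) / 2) * (1 + ‖y.2.2‖ ^ 2) ^ ((s : ℝ) / 2)

theorem weight_pos {d : ℕ} (r s : ℕ) (y : Y d) : 0 < weight r s y := by
  unfold weight; positivity

theorem radialExt_coe {d : ℕ} (g : Sph d → ℂ) (u : Sph d) : radialExt g u = g u := by
  have hu : (u : Rn d) ≠ 0 := ne_zero_of_mem_unit_sphere u
  have hn : ‖(u : Rn d)‖ = 1 := by simp
  rw [radialExt, dif_pos hu]
  congr 1
  ext1
  simp [hn]

/-- A smooth function on `𝕐²ⁿ` extends to a smooth function of `(x, b, a)`, `x ≠ 0`. -/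
theorem SmoothY.contDiffAt {d : ℕ} {Φ : Y d → ℂ} (hΦ : SmoothY Φ) (x : Rn d) (hx : x ≠ 0)
    (z : ℝ × Rn d) :
    ContDiffAt ℝ ∞ (fun p : Rn d × ℝ × Rn d => radialExt (fun u => Φ (u, p.2)) p.1) (x, z) := by
  let U : TopologicalSpace.Opens (Rn d × ℝ × Rn d) := ⟨{p | p.1 ≠ 0}, by
    exact isOpen_ne_fun continuous_fst continuous_const⟩
  have hf : ContMDiff 𝓘(ℝ, Rn d × ℝ × Rn d) 𝓘(ℝ, Rn d) ∞
      (fun p : U => ‖p.1.1‖⁻¹ • p.1.1) := by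
    intro p
    have hp : p.1.1 ≠ 0 := p.2
    refine (contMDiffAt_subtype_iff (f := fun p : Rn d × ℝ × Rn d => ‖p.1‖⁻¹ • p.1)).2 ?_
    rw [contMDiffAt_iff_contDiffAt]
    exact (((contDiffAt_fst).norm ℝ hp).inv (norm_ne_zero_iff.2 hp)).smul contDiffAt_fst
  have hf' : ∀ p : U, ‖p.1.1‖⁻¹ • p.1.1 ∈ Metric.sphere (0 : Rn d) 1 := fun p => by
    have hp : p.1.1 ≠ 0 := p.2
    simp [norm_smul, hp]
  have := Fact.mk (@finrank_euclideanSpace_fin ℝ _ (d + 1))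
  have h1 := ContMDiff.codRestrict_sphere (n := d) hf hf'
  have h2 : ContMDiff 𝓘(ℝ, Rn d × ℝ × Rn d) 𝓘(ℝ, ℝ) ∞ (fun p : U => p.1.2.1) := by
    intro p
    refine (contMDiffAt_subtype_iff (f := fun p : Rn d × ℝ × Rn d => p.2.1)).2 ?_
    rw [contMDiffAt_iff_contDiffAt]
    exact contDiffAt_snd.fst
  have h2' : ContMDiff 𝓘(ℝ, Rn d × ℝ × Rn d) 𝓘(ℝ, Rn d) ∞ (fun p : U => p.1.2.2) := by
    intro p
    refine (contMDiffAt_subtype_iff (f := fun p : Rn d × ℝ × Rn d => p.2.2)).2 ?_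
    rw [contMDiffAt_iff_contDiffAt]
    exact contDiffAt_snd.snd
  have h3 := (ContMDiff.comp hΦ (h1.prodMk (h2.prodMk h2'))) ⟨(x, z), hx⟩
  rw [← contMDiffAt_iff_contDiffAt]
  refine (contMDiffAt_subtype_iff (U := U) (x := ⟨(x, z), hx⟩)).1 (h3.congr_of_eventuallyEq ?_)
  refine Eventually.of_forall fun p => ?_
  have hp : p.1.1 ≠ 0 := p.2
  simp only [radialExt, dif_pos hp]
  rfl

theorem smoothY_of_contDiffAt {d : ℕ} {Φ : Y d → ℂ} (F : Rn d × ℝ × Rn d → ℂ)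
    (hF : ∀ (u : Sph d) z, ContDiffAt ℝ ∞ F ((u : Rn d), z))
    (h : ∀ y : Y d, Φ y = F ((y.1 : Rn d), y.2)) : SmoothY Φ := by
  have h0 : Φ = fun y => F ((y.1 : Rn d), y.2) := funext h
  intro y
  rw [h0]
  have := Fact.mk (@finrank_euclideanSpace_fin ℝ _ (d + 1))
  have hc : ContMDiff (𝓡 d) 𝓘(ℝ, Rn d) ∞ ((↑) : Sph d → Rn d) := contMDiff_coe_sphere
  have h1 : ContMDiff ((𝓡 d).prod (𝓘(ℝ, ℝ).prod 𝓘(ℝ, Rn d))) 𝓘(ℝ, Rn d × ℝ × Rn d) ∞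
      (fun y : Y d => ((y.1 : Rn d), y.2)) :=
    (hc.comp contMDiff_fst).prodMk_space ((contMDiff_fst.comp contMDiff_snd).prodMk_space
      (contMDiff_snd.comp contMDiff_snd))
  exact ((hF y.1 y.2).contMDiffAt).comp y (h1 y)

theorem SmoothY.lapU {d : ℕ} {Φ : Y d → ℂ} (hΦ : SmoothY Φ) : SmoothY (lapU Φ) := by
  refine smoothY_of_contDiffAt
    (fun p => (Δ (radialExt (fun u => Φ (u, p.2)))) p.1) (fun u z => ?_) fun y => rfl
  simp only [InnerProductSpace.laplacian_eq_iteratedFDeriv_stdOrthonormalBasis,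
    iteratedFDeriv_two_apply]
  refine ContDiffAt.sum fun i _ => ?_
  have hu : (u : Rn d) ≠ 0 := ne_zero_of_mem_unit_sphere u
  have hev : ∀ᶠ q : (Rn d × ℝ × Rn d) × Rn d in 𝓝 (((u : Rn d), z), (u : Rn d)), q.2 ≠ 0 :=
    continuousAt_snd.eventually_ne hu
  have h1 : ∀ q : (Rn d × ℝ × Rn d) × Rn d, q.2 ≠ 0 → ContDiffAt ℝ ∞
      (fun q : (Rn d × ℝ × Rn d) × Rn d =>
        fderiv ℝ (radialExt (fun u => Φ (u, q.1.2))) q.2) q := by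
    intro q hq
    refine ContDiffAt.fderiv (n := ∞)
      (f := fun (q : (Rn d × ℝ × Rn d) × Rn d) => radialExt (fun u => Φ (u, q.1.2)))
      (g := fun q => q.2) ?_ contDiffAt_snd (by simp)
    have := hΦ.contDiffAt q.2 hq q.1.2
    exact this.comp (f := fun w : ((Rn d × ℝ × Rn d) × Rn d) × Rn d => (w.2, w.1.1.2))
      (q, q.2) (by fun_prop)
  have h2 : ContDiffAt ℝ ∞ (fun p : Rn d × ℝ × Rn d =>
      fderiv ℝ (fderiv ℝ (radialExt (fun u => Φ (u, p.2)))) p.1) ((u : Rn d), z) := by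
    refine ContDiffAt.fderiv (n := ∞)
      (f := fun (p : Rn d × ℝ × Rn d) => fderiv ℝ (radialExt (fun u => Φ (u, p.2))))
      (g := fun p => p.1) ?_ contDiffAt_fst (by simp)
    exact h1 (((u : Rn d), z), (u : Rn d)) hu
  exact (h2.clm_apply contDiffAt_const).clm_apply contDiffAt_const

theorem SmoothY.lapU_iterate {d : ℕ} {Φ : Y d → ℂ} (hΦ : SmoothY Φ) (k : ℕ) :
    SmoothY (DSTFRFT.lapU^[k] Φ) := by
  induction k with
  | zero => exact hΦ
  | succ k ih => rw [Function.iterate_succ_apply']; exact ih.lapU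

theorem SmoothY.contDiff_slice {d : ℕ} {Φ : Y d → ℂ} (hΦ : SmoothY Φ) (u : Sph d) :
    ContDiff ℝ ∞ (fun z : ℝ × Rn d => Φ (u, z)) := by
  rw [contDiff_iff_contDiffAt]
  intro z
  have h := hΦ.contDiffAt u (ne_zero_of_mem_unit_sphere u) z
  have h2 := h.comp (f := fun z : ℝ × Rn d => ((u : Rn d), z)) z (by fun_prop)
  refine h2.congr_of_eventuallyEq (Eventually.of_forall fun w => ?_)
  exact (radialExt_coe (fun u => Φ (u, w)) u).symm

theorem contDiff_iteratedDeriv_fst {d : ℕ} {h : ℝ × Rn d → ℂ} (hh : ContDiff ℝ ∞ h) (m : ℕ) :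
    ContDiff ℝ ∞ (fun z : ℝ × Rn d => iteratedDeriv m (fun b => h (b, z.2)) z.1) := by
  induction m with
  | zero => simpa using hh
  | succ m ih =>
    simp only [iteratedDeriv_succ, ← fderiv_apply_one_eq_deriv]
    have : ContDiff ℝ ∞ (fun z : ℝ × Rn d =>
        fderiv ℝ (iteratedDeriv m (fun b => h (b, z.2))) z.1) := by
      refine ContDiff.fderiv (m := ∞) (n := ∞)
        (f := fun z : ℝ × Rn d => iteratedDeriv m (fun b => h (b, z.2))) ?_ contDiff_fst (by simp)
      exact ih.comp (f := fun w : (ℝ × Rn d) × ℝ => (w.2, w.1.2)) (by fun_prop)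
    exact this.clm_apply contDiff_const

theorem SmoothY.add {d : ℕ} {Φ Ψ : Y d → ℂ} (hΦ : SmoothY Φ) (hΨ : SmoothY Ψ) :
    SmoothY (Φ + Ψ) := ContMDiff.add hΦ hΨ

theorem SmoothY.smul {d : ℕ} {Φ : Y d → ℂ} (c : ℂ) (hΦ : SmoothY Φ) : SmoothY (c • Φ) :=
  ((contDiff_const_smul (𝕜 := ℝ) c).contMDiff).comp hΦ

theorem natCast_le_infty (l : ℕ) : (l : ℕ∞ω) ≤ ∞ := by
  exact_mod_cast (le_top : (l : ℕ∞) ≤ ⊤)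

theorem two_le_infty : (2 : ℕ∞ω) ≤ ∞ := natCast_le_infty 2

theorem SmoothY.contDiffAt_radialExt {d : ℕ} {Φ : Y d → ℂ} (hΦ : SmoothY Φ) (y : Y d) :
    ContDiffAt ℝ 2 (radialExt (fun u => Φ (u, y.2))) (y.1 : Rn d) := by
  have h := hΦ.contDiffAt y.1 (ne_zero_of_mem_unit_sphere y.1) y.2
  exact (h.comp (f := fun x : Rn d => (x, y.2)) (y.1 : Rn d) (by fun_prop)).of_le two_le_infty

theorem lapU_iterate_add {d : ℕ} {Φ Ψ : Y d → ℂ} (hΦ : SmoothY Φ) (hΨ : SmoothY Ψ) (k : ℕ) :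
    lapU^[k] (Φ + Ψ) = lapU^[k] Φ + lapU^[k] Ψ := by
  induction k with
  | zero => rfl
  | succ k ih =>
    simp only [Function.iterate_succ_apply', ih]
    funext y
    have e : radialExt (fun u => (lapU^[k] Φ + lapU^[k] Ψ) (u, y.2)) =
        radialExt (fun u => (lapU^[k] Φ) (u, y.2)) +
          radialExt (fun u => (lapU^[k] Ψ) (u, y.2)) := by
      funext x; by_cases h : x = 0 <;> simp [radialExt, h]
    change (Δ (radialExt fun u => (lapU^[k] Φ + lapU^[k] Ψ) (u, y.2))) (y.1 : Rn d) =
      (Δ (radialExt fun u => (lapU^[k] Φ) (u, y.2))) (y.1 : Rn d) +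
      (Δ (radialExt fun u => (lapU^[k] Ψ) (u, y.2))) (y.1 : Rn d)
    rw [e]
    exact (hΦ.lapU_iterate k |>.contDiffAt_radialExt y).laplacian_add
      (hΨ.lapU_iterate k |>.contDiffAt_radialExt y)

theorem lapU_iterate_smul {d : ℕ} {Φ : Y d → ℂ} (c : ℂ) (hΦ : SmoothY Φ) (k : ℕ) :
    lapU^[k] (c • Φ) = c • lapU^[k] Φ := by
  induction k with
  | zero => rfl
  | succ k ih =>
    simp only [Function.iterate_succ_apply', ih]
    funext y
    have e : radialExt (fun u => (c • lapU^[k] Φ) (u, y.2)) =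
        c • radialExt (fun u => (lapU^[k] Φ) (u, y.2)) := by
      funext x; by_cases h : x = 0 <;> simp [radialExt, h]
    change (Δ (radialExt fun u => (c • lapU^[k] Φ) (u, y.2))) (y.1 : Rn d) =
      c • (Δ (radialExt fun u => (lapU^[k] Φ) (u, y.2))) (y.1 : Rn d)
    rw [e]
    exact InnerProductSpace.laplacian_smul c (hΦ.lapU_iterate k |>.contDiffAt_radialExt y)

theorem diffY_add {d : ℕ} (k m l : ℕ) {Φ Ψ : Y d → ℂ} (hΦ : SmoothY Φ) (hΨ : SmoothY Ψ)
    (y : Y d) : diffY k m l (Φ + Ψ) y = diffY k m l Φ y + diffY k m l Ψ y := by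
  have h1 := (hΦ.lapU_iterate k).contDiff_slice y.1
  have h2 := (hΨ.lapU_iterate k).contDiff_slice y.1
  have g1 := (contDiff_iteratedDeriv_fst h1 m).comp (f := fun a : Rn d => (y.2.1, a)) (by fun_prop)
  have g2 := (contDiff_iteratedDeriv_fst h2 m).comp (f := fun a : Rn d => (y.2.1, a)) (by fun_prop)
  simp only [diffY, lapU_iterate_add hΦ hΨ, Pi.add_apply]
  have e : (fun a => iteratedDeriv m
      (fun b => (lapU^[k] Φ) (y.1, b, a) + (lapU^[k] Ψ) (y.1, b, a)) y.2.1) =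
      (fun a => iteratedDeriv m (fun b => (lapU^[k] Φ) (y.1, b, a)) y.2.1) +
      (fun a => iteratedDeriv m (fun b => (lapU^[k] Ψ) (y.1, b, a)) y.2.1) := by
    funext a
    refine iteratedDeriv_fun_add ?_ ?_
    · exact ((h1.comp (f := fun b : ℝ => (b, a)) (by fun_prop)).of_le
        (natCast_le_infty m)).contDiffAt
    · exact ((h2.comp (f := fun b : ℝ => (b, a)) (by fun_prop)).of_le
        (natCast_le_infty m)).contDiffAt
  rw [e]
  exact iteratedFDeriv_add_apply (g1.of_le (natCast_le_infty l)).contDiffAt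
    (g2.of_le (natCast_le_infty l)).contDiffAt

theorem diffY_smul {d : ℕ} (k m l : ℕ) {Φ : Y d → ℂ} (c : ℂ) (hΦ : SmoothY Φ)
    (y : Y d) : diffY k m l (c • Φ) y = c • diffY k m l Φ y := by
  have h1 := (hΦ.lapU_iterate k).contDiff_slice y.1
  have g1 := (contDiff_iteratedDeriv_fst h1 m).comp (f := fun a : Rn d => (y.2.1, a)) (by fun_prop)
  simp only [diffY, lapU_iterate_smul c hΦ, Pi.smul_apply]
  have e : (fun a => iteratedDeriv m (fun b => c • (lapU^[k] Φ) (y.1, b, a)) y.2.1) =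
      c • (fun a => iteratedDeriv m (fun b => (lapU^[k] Φ) (y.1, b, a)) y.2.1) := by
    funext a
    simp only [smul_eq_mul, Pi.smul_apply]
    exact iteratedDeriv_const_mul_field c _
  rw [e]
  exact iteratedFDeriv_const_smul_apply (g1.of_le (natCast_le_infty l)).contDiffAt

theorem diffY_zero {d : ℕ} (k m l : ℕ) (y : Y d) : diffY k m l (0 : Y d → ℂ) y = 0 := by
  have h0 : SmoothY (0 : Y d → ℂ) := contMDiff_const
  have h := diffY_smul k m l (0 : ℂ) h0 y
  have h1 : (0 : ℂ) • diffY k m l (0 : Y d → ℂ) y = 0 := by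
    ext v; simp
  rwa [h1, smul_zero] at h

/-- Membership in `𝓢(𝕐²ⁿ)`: smoothness and finiteness of
`sup (1 + |b|²)^(r/2) (1 + |a|²)^(s/2) |∂_a^l ∂_b^m Δ_u^k Φ|` for all `r, s, k, m, l`. -/
def schwartzYSubmodule (d : ℕ) : Submodule ℂ (Y d → ℂ) where
  carrier := {Φ | SmoothY Φ ∧ ∀ r s k m l : ℕ,
    BddAbove (range fun y => weight r s y * ‖diffY k m l Φ y‖)}
  zero_mem' := by
    have h0 : SmoothY (0 : Y d → ℂ) := contMDiff_const
    refine ⟨h0, fun r s k m l => ⟨0, ?_⟩⟩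
    rintro _ ⟨y, rfl⟩
    simp [diffY_zero]
  add_mem' := by
    rintro Φ Ψ ⟨hΦ, h1⟩ ⟨hΨ, h2⟩
    refine ⟨hΦ.add hΨ, fun r s k m l => ?_⟩
    obtain ⟨A, hA⟩ := h1 r s k m l
    obtain ⟨B, hB⟩ := h2 r s k m l
    refine ⟨A + B, ?_⟩
    rintro _ ⟨y, rfl⟩
    have a1 := hA ⟨y, rfl⟩
    have b1 := hB ⟨y, rfl⟩
    have := mul_le_mul_of_nonneg_left (norm_add_le (diffY k m l Φ y) (diffY k m l Ψ y))
      (weight_pos r s y).le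
    simp only [diffY_add k m l hΦ hΨ] at *
    linarith
  smul_mem' := by
    rintro c Φ ⟨hΦ, h1⟩
    refine ⟨hΦ.smul c, fun r s k m l => ?_⟩
    obtain ⟨A, hA⟩ := h1 r s k m l
    refine ⟨‖c‖ * A, ?_⟩
    rintro _ ⟨y, rfl⟩
    have a1 := mul_le_mul_of_nonneg_left (hA ⟨y, rfl⟩) (norm_nonneg c)
    simp only [diffY_smul k m l c hΦ, norm_smul] at *
    linarith

/-- The space `𝓢(𝕐²ⁿ)`. -/
def SchwartzY (d : ℕ) : Type := schwartzYSubmodule d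

instance (d : ℕ) : AddCommGroup (SchwartzY d) :=
  inferInstanceAs (AddCommGroup (schwartzYSubmodule d))

instance (d : ℕ) : Module ℂ (SchwartzY d) :=
  inferInstanceAs (Module ℂ (schwartzYSubmodule d))

instance (d : ℕ) : CoeFun (SchwartzY d) (fun _ => Y d → ℂ) := ⟨fun Φ => Φ.1⟩

/-- The seminorm
`ρ(Φ) = sup (1 + |b|²)^(r/2) (1 + |a|²)^(s/2) |∂_a^l ∂_b^m Δ_u^k Φ(u, b, a)|`,
indexed by `(r, s, k, m, l)`. -/
def seminormY (d : ℕ) (i : ℕ × ℕ × ℕ × ℕ × ℕ) : Seminorm ℂ (SchwartzY d) :=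
  Seminorm.ofSMulLE
    (fun Φ => ⨆ y, weight i.1 i.2.1 y * ‖diffY i.2.2.1 i.2.2.2.1 i.2.2.2.2 Φ y‖)
    (by
      have e : ∀ y, diffY i.2.2.1 i.2.2.2.1 i.2.2.2.2 (0 : SchwartzY d) y = 0 :=
        fun y => diffY_zero _ _ _ y
      simp [e])
    (fun Φ Ψ => by
      refine Real.iSup_le (fun y => ?_) (add_nonneg ?_ ?_)
      · have a1 := le_ciSup (Φ.2.2 i.1 i.2.1 i.2.2.1 i.2.2.2.1 i.2.2.2.2) y
        have b1 := le_ciSup (Ψ.2.2 i.1 i.2.1 i.2.2.1 i.2.2.2.1 i.2.2.2.2) y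
        have e := diffY_add i.2.2.1 i.2.2.2.1 i.2.2.2.2 Φ.2.1 Ψ.2.1 y
        have := mul_le_mul_of_nonneg_left (norm_add_le (diffY i.2.2.1 i.2.2.2.1 i.2.2.2.2 Φ.1 y)
          (diffY i.2.2.1 i.2.2.2.1 i.2.2.2.2 Ψ.1 y)) (weight_pos i.1 i.2.1 y).le
        rw [← e] at this
        refine this.trans ?_
        rw [mul_add]
        exact add_le_add a1 b1
      · exact Real.iSup_nonneg fun y => mul_nonneg (weight_pos _ _ y).le (norm_nonneg _)
      · exact Real.iSup_nonneg fun y => mul_nonneg (weight_pos _ _ y).le (norm_nonneg _))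
    (fun c Φ => by
      refine Real.iSup_le (fun y => ?_) (mul_nonneg (norm_nonneg _)
        (Real.iSup_nonneg fun y => mul_nonneg (weight_pos _ _ y).le (norm_nonneg _)))
      have a1 := le_ciSup (Φ.2.2 i.1 i.2.1 i.2.2.1 i.2.2.2.1 i.2.2.2.2) y
      have e := diffY_smul i.2.2.1 i.2.2.2.1 i.2.2.2.2 c Φ.2.1 y
      have := mul_le_mul_of_nonneg_left a1 (norm_nonneg c)
      refine le_trans (le_of_eq ?_) this
      have e' : diffY i.2.2.1 i.2.2.2.1 i.2.2.2.2 (c • Φ : SchwartzY d) y =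
        c • diffY i.2.2.1 i.2.2.2.1 i.2.2.2.2 Φ.1 y := e
      rw [e', norm_smul]
      ring)

/-- The family of seminorms defining the topology of `𝓢(𝕐²ⁿ)`. -/
def seminormFamilyY (d : ℕ) : SeminormFamily ℂ (SchwartzY d) (ℕ × ℕ × ℕ × ℕ × ℕ) :=
  seminormY d

instance (d : ℕ) : TopologicalSpace (SchwartzY d) :=
  (seminormFamilyY d).moduleFilterBasis.topology'

theorem withSeminormsY (d : ℕ) : WithSeminorms (seminormFamilyY d) := ⟨rfl⟩

/-- The slice `a ↦ Φ(u, b, a)`, a Schwartz function on `ℝⁿ`. -/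
def SchwartzY.slice {d : ℕ} (Φ : SchwartzY d) (u : Sph d) (b : ℝ) : 𝓢(Rn d, ℂ) where
  toFun a := Φ (u, b, a)
  smooth' := (Φ.2.1.contDiff_slice u).comp (f := fun a : Rn d => (b, a)) (by fun_prop)
  decay' k l := by
    obtain ⟨C, hC⟩ := Φ.2.2 0 k 0 0 l
    refine ⟨C, fun a => le_trans ?_ (hC ⟨(u, b, a), rfl⟩)⟩
    simp only [diffY, weight, Function.iterate_zero, id_eq, iteratedDeriv_zero, Nat.cast_zero,
      zero_div, Real.rpow_zero, one_mul]
    refine mul_le_mul_of_nonneg_right ?_ (norm_nonneg _)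
    have h : ‖a‖ ^ k = (‖a‖ ^ 2) ^ ((k : ℝ) / 2) := by
      rw [← Real.rpow_natCast ‖a‖ 2, ← Real.rpow_mul (norm_nonneg a), ← Real.rpow_natCast]
      congr 1
      push_cast
      ring
    rw [h]
    exact Real.rpow_le_rpow (by positivity) (by linarith) (by positivity)

/-- The space `𝓢'(𝕐²ⁿ)`. -/
abbrev TDY (d : ℕ) : Type := StrongDual ℂ (SchwartzY d)

/-! ### The directional short-time fractional Fourier transform -/

/-- The synthesis operator
`((DS_ψ^α)^* Φ)(x) = ∫_{𝕊ⁿ⁻¹} ∫_{ℝⁿ} ∫_ℝ Φ(u, b, a) ψ(x · u - b) K_{-α}(x, a) db da du`. -/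
def dsSynth {d : ℕ} (α : Fin (d + 1) → ℝ) (ψ : 𝓢(ℝ, ℂ)) (Φ : Y d → ℂ) (x : Rn d) : ℂ :=
  ∫ u, (∫ a, ∫ b, Φ (u, b, a) * ψ (⟪x, (u : Rn d)⟫_ℝ - b) * fracKernel (-α) x a)
    ∂(sphereMeasure d)

/-- `T` is the transform `DS_ψ^α f ∈ 𝓢'(𝕐²ⁿ)` of the tempered distribution `f`:
for every test function `Φ`, the function `conj ((DS_ψ^α)^* (conj Φ))` belongs to `𝓢(ℝⁿ)` and
`⟨T, Φ⟩ = ⟨f, conj ((DS_ψ^α)^* (conj Φ))⟩`. There is at most one such `T`. -/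
def IsDS {d : ℕ} (α : Fin (d + 1) → ℝ) (ψ : 𝓢(ℝ, ℂ)) (f : TD d) (T : TDY d) : Prop :=
  ∀ Φ : SchwartzY d, ∃ g : 𝓢(Rn d, ℂ),
    (∀ x, g x = conj (dsSynth α ψ (fun y => conj (Φ y)) x)) ∧ T Φ = f g

theorem IsDS.unique {d : ℕ} {α : Fin (d + 1) → ℝ} {ψ : 𝓢(ℝ, ℂ)} {f : TD d} {T T' : TDY d}
    (h : IsDS α ψ f T) (h' : IsDS α ψ f T') : T = T' := by
  ext Φ
  obtain ⟨g, hg, e⟩ := h Φ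
  obtain ⟨g', hg', e'⟩ := h' Φ
  have : g = g' := by ext x; rw [hg, hg']
  rw [e, e', this]

/-- The `𝓢'(ℝⁿ)`-valued function `(u, b) ↦ 𝓕_α(f · ψ̄(· · u - b))` on `𝕊ⁿ⁻¹ × ℝ`. -/
def dsFun {d : ℕ} (α : Fin (d + 1) → ℝ) (hα : ∀ k, Real.sin (α k) ≠ 0) (ψ : 𝓢(ℝ, ℂ)) (f : TD d)
    (p : Sph d × ℝ) : TD d :=
  frftTD α hα (mulWindow ψ p.1 p.2 f)

/-- `T ∈ 𝓢'(𝕐²ⁿ)` is given by the `𝓢'(ℝⁿ)`-valued function `F` on `𝕊ⁿ⁻¹ × ℝ`: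
`⟨T, Φ⟩ = ∫_{𝕊ⁿ⁻¹} ∫_ℝ ⟨F(u, b), Φ(u, b, ·)⟩ db du`, the integral being absolutely convergent. -/
def IsGivenBy {d : ℕ} (T : TDY d) (F : Sph d × ℝ → TD d) : Prop :=
  ∀ Φ : SchwartzY d,
    Integrable (fun p : Sph d × ℝ => F p (Φ.slice p.1 p.2)) ((sphereMeasure d).prod volume) ∧
    T Φ = ∫ u, (∫ b, F (u, b) (Φ.slice u b)) ∂(sphereMeasure d)

/-! ### Smoothness and slow growth of functions with values in a locally convex space -/

section Smooth

variable {X : Type*} [NormedAddCommGroup X] [NormedSpace ℝ X]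
  {V : Type*} [AddCommGroup V] [Module ℝ V] [TopologicalSpace V]

/-- `g` is of class `C^k` on the open subset `U` of a finite-dimensional space, with values in a
topological vector space: `g` is continuous and, if `k > 0`, all its directional derivatives
(limits of difference quotients) exist and are of class `C^(k-1)`. -/
def IsCkOn (U : Set X) : ℕ → (X → V) → Prop
  | 0, g => ContinuousOn g U
  | k + 1, g => ContinuousOn g U ∧ ∀ v : X, ∃ g' : X → V,
      (∀ x ∈ U, Tendsto (fun t : ℝ => t⁻¹ • (g (x + t • v) - g x)) (𝓝[≠] 0) (𝓝 (g' x))) ∧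
      IsCkOn U k g'

/-- `F : M → V` is of class `C^∞` on the (boundaryless) manifold `M`, that is, in the charts of an
atlas. -/
def IsSmooth {H : Type*} [TopologicalSpace H] (I : ModelWithCorners ℝ X H)
    {M : Type*} [TopologicalSpace M] [ChartedSpace H M] (F : M → V) : Prop :=
  ∀ (p : M) (k : ℕ), IsCkOn (extChartAt I p).target k (F ∘ (extChartAt I p).symm)

end Smooth

/-- `F : 𝕊ⁿ⁻¹ × ℝ → V` is of slow growth: for some `s`, the family `(1 + |b|)^(-s) F(u, b)` is
bounded in the locally convex space `V`, that is, every continuous seminorm is bounded on it. -/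
def SlowGrowth {d : ℕ} {V : Type*} [AddCommGroup V] [Module ℂ V] [TopologicalSpace V]
    (F : Sph d × ℝ → V) : Prop :=
  ∃ s : ℕ, ∀ p : Seminorm ℂ V, Continuous p →
    ∃ C > 0, ∀ (u : Sph d) (b : ℝ), p (F (u, b)) ≤ C * (1 + |b|) ^ s

end DSTFRFT

end

/-! Since $\overline{K_{-\alpha}(x,a)}=K_\alpha(a,x)$ (`conj_fracKernel_neg`), Fubini turns
$\overline{(DS^\alpha_\psi)^*(\overline\Phi)}$ into the integral over $(u,b)$ of the Schwartz
functions $G(u,b)=\overline\psi((\cdot)\cdot u-b)\,\mathcal F_\alpha(\Phi(u,b,\cdot))$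
(`synth_apply`). Because $|u|=1$, multiplication by the ridge function is equicontinuous on
$\mathcal S(\mathbb R^n)$, uniformly in $b$, and the decay of $\Phi$ in $b$ makes every seminorm of
$G(u,b)$ at most a constant times $(1+b^2)^{-1}$. So the integral of $G$ is a Schwartz function
(`integralFamily`), $f$ may be applied under the integral (`dual_integralFamily`), and $\langle
f,G(u,b)\rangle=\langle F(u,b),\Phi(u,b,\cdot)\rangle$ by the definitions. The same bound gives
continuity in $\Phi$.

To apply $f$ under the integral, $f$ is bounded by finitely many Schwartz seminorms, so by
Hahn–Banach it factors through a Banach space of weighted derivatives, where Bochner integrals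
commute with continuous functionals.

For smoothness, $u$ is replaced by $v\in\mathbb R^n$ with $|v|\le 1$. The derivative of $\chi(x\cdot
v-b)$ in the direction $(w,c)$ is $(x\cdot w-c)\,\chi'(x\cdot v-b)$: again a ridge function, with an
affine factor that is moved onto the test function. Hence the class `ridgeDual` is stable under
differentiation up to smooth coefficients, and induction on the order applies (`isCkOn_ridgeDual`).
All limits are taken in the strong topology through estimates $|T\varphi|\le c\,Q(\varphi)$ with a
fixed continuous seminorm $Q$, which are uniform on bounded sets. Slow growth holds with exponent
$0$, because one $Q$ dominates all the functionals $F(u,b)$. -/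

noncomputable section

namespace DSTFRFT

/-! ### Continuity and integration of families of Schwartz functions -/

section Families

variable {P : Type*} [TopologicalSpace P] {E F : Type} [NormedAddCommGroup E] [NormedSpace ℝ E]
  [NormedAddCommGroup F] [NormedSpace ℝ F]

/-- A family of Schwartz functions is continuous if all its derivatives are jointly continuous and
all its seminorms are locally bounded. -/
theorem continuous_of_continuous_iteratedFDeriv [ProperSpace E] {G : P → 𝓢(E, F)}
    (hc : ∀ l, Continuous fun q : P × E => iteratedFDeriv ℝ l (G q.1) q.2)
    (hb : ∀ k l p₀, ∃ C, ∀ᶠ p in 𝓝 p₀, SchwartzMap.seminorm ℝ k l (G p) ≤ C) :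
    Continuous G := by
  rw [continuous_iff_continuousAt]
  intro p₀
  rw [ContinuousAt, (schwartz_withSeminorms ℝ E F).tendsto_nhds]
  rintro ⟨k, l⟩ ε hε
  -- One extra power of $|x|$ controls the tail outside a ball of radius $R$; inside the ball,
  -- compactness gives uniform convergence.
  obtain ⟨C, hC⟩ := hb (k + 1) l p₀
  have hC0 : 0 ≤ C := (apply_nonneg _ _).trans hC.self_of_nhds
  -- Chosen so that $R\varepsilon/2>2C$, which makes the tail at most $\varepsilon/2$; then $\delta$
  -- is fixed by $R^k\delta=\varepsilon/2$.
  set R : ℝ := 4 * C / ε + 1 with hR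
  have hR0 : 0 < R := by positivity
  set δ : ℝ := ε / (2 * R ^ k) with hδ
  have hδ0 : 0 < δ := by positivity
  have hloc : ∀ᶠ p in 𝓝 p₀, ∀ x ∈ Metric.closedBall (0 : E) R,
      ‖iteratedFDeriv ℝ l (G p) x - iteratedFDeriv ℝ l (G p₀) x‖ < δ := by
    refine (isCompact_closedBall (0 : E) R).eventually_forall_of_forall_eventually fun x _ => ?_
    have h2 : Continuous fun q : P × E =>
        ‖iteratedFDeriv ℝ l (G q.1) q.2 - iteratedFDeriv ℝ l (G p₀) q.2‖ :=
      ((hc l).sub ((hc l).comp (f := fun q : P × E => (p₀, q.2)) (by fun_prop))).norm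
    have h3 := h2.tendsto (p₀, x)
    simp only [sub_self, norm_zero] at h3
    exact h3.eventually_lt_const hδ0
  filter_upwards [hC, hloc] with p h1 h2
  change SchwartzMap.seminorm ℝ k l (G p - G p₀) < ε
  refine lt_of_le_of_lt (SchwartzMap.seminorm_le_bound ℝ k l _ (M := ε / 2) (by positivity)
    fun x => ?_) (half_lt_self hε)
  have hsub : iteratedFDeriv ℝ l (⇑(G p - G p₀)) x =
      iteratedFDeriv ℝ l (G p) x - iteratedFDeriv ℝ l (G p₀) x :=
    iteratedFDeriv_sub_apply ((G p).contDiffAt l) ((G p₀).contDiffAt l)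
  rw [hsub]
  by_cases hx : ‖x‖ ≤ R
  · have h4 := (h2 x (by simpa using hx)).le
    calc ‖x‖ ^ k * _ ≤ R ^ k * δ := by gcongr
      _ = ε / 2 := by rw [hδ]; field_simp
  · push Not at hx
    have a1 := (SchwartzMap.le_seminorm ℝ (k + 1) l (G p) x).trans h1
    have a2 := (SchwartzMap.le_seminorm ℝ (k + 1) l (G p₀) x).trans hC.self_of_nhds
    have a3 := norm_sub_le (iteratedFDeriv ℝ l (G p) x) (iteratedFDeriv ℝ l (G p₀) x)
    have hx0 : 0 < ‖x‖ := hR0.trans hx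
    have a4 : ‖x‖ * (‖x‖ ^ k *
        ‖iteratedFDeriv ℝ l (G p) x - iteratedFDeriv ℝ l (G p₀) x‖) ≤ 2 * C := by
      have := mul_le_mul_of_nonneg_left a3 (pow_nonneg hx0.le (k + 1))
      rw [mul_add] at this
      rw [← mul_assoc, ← pow_succ']
      linarith
    by_contra! h
    have a5 : R * (ε / 2) < ‖x‖ * (‖x‖ ^ k *
        ‖iteratedFDeriv ℝ l (G p) x - iteratedFDeriv ℝ l (G p₀) x‖) :=
      mul_lt_mul hx h.le (by positivity) hx0.le
    have a6 : R * (ε / 2) = 2 * C + ε / 2 := by rw [hR]; field_simp; ring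
    linarith

/-- The partial derivatives of a jointly smooth function are jointly smooth. -/
theorem contDiffAt_iteratedFDeriv_snd {X : Type*} [NormedAddCommGroup X] [NormedSpace ℝ X]
    {h : X × E → F} {U : Set X}
    (hh : ∀ q : X × E, q.1 ∈ U → ContDiffAt ℝ ∞ h q) (l : ℕ) (q : X × E) (hq : q.1 ∈ U) :
    ContDiffAt ℝ ∞ (fun q : X × E => iteratedFDeriv ℝ l (fun x => h (q.1, x)) q.2) q := by
  induction l generalizing q with
  | zero =>
    simp only [iteratedFDeriv_zero_eq_comp, Function.comp_apply]
    exact (continuousMultilinearCurryFin0 ℝ E F).symm.contDiff.contDiffAt.comp q (hh q hq)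
  | succ l ih =>
    simp only [iteratedFDeriv_succ_eq_comp_left, Function.comp_apply]
    refine (LinearIsometryEquiv.contDiff (𝕜 := ℝ) (E := E →L[ℝ] (E [×l]→L[ℝ] F))
      (F := E [×(l + 1)]→L[ℝ] F) (continuousMultilinearCurryLeftEquiv ℝ
      (fun _ : Fin (l + 1) => E) F).symm).contDiffAt.comp q ?_
    refine ContDiffAt.fderiv (n := ∞)
      (f := fun q : X × E => iteratedFDeriv ℝ l (fun x => h (q.1, x)))
      (g := fun q => q.2) ?_ contDiffAt_snd (by simp)
    exact (ih q hq).comp (f := fun w : (X × E) × E => (w.1.1, w.2)) (q, q.2) (by fun_prop)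

theorem seminorm_fderivCLM_le (k l : ℕ) (φ : 𝓢(E, F)) :
    SchwartzMap.seminorm ℝ k l (SchwartzMap.fderivCLM ℝ E F φ) ≤
      SchwartzMap.seminorm ℝ k (l + 1) φ := by
  refine SchwartzMap.seminorm_le_bound ℝ k l _ (apply_nonneg _ _) fun x => ?_
  have e : ⇑(SchwartzMap.fderivCLM ℝ E F φ) = fderiv ℝ φ := by
    funext x; exact rfl
  rw [e, norm_iteratedFDeriv_fderiv]
  exact SchwartzMap.le_seminorm ℝ k (l + 1) φ x

theorem continuous_seminorm_comp {G : P → 𝓢(E, F)} (hG : Continuous G) (k l : ℕ) :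
    Continuous fun p => SchwartzMap.seminorm ℝ k l (G p) :=
  ((schwartz_withSeminorms ℝ E F).continuous_seminorm (k, l)).comp hG

theorem continuous_evalAt (x : E) : Continuous fun φ : 𝓢(E, F) => φ x := by
  exact (BoundedContinuousFunction.evalCLM ℝ x).continuous.comp
    (SchwartzMap.toBoundedContinuousFunctionCLM ℝ E F).continuous

theorem continuous_apply_family {G : P → 𝓢(E, F)} (hG : Continuous G) (x : E) :
    Continuous fun p => G p x := (continuous_evalAt x).comp hG

variable [MeasurableSpace P] [OpensMeasurableSpace P] [SecondCountableTopology P] {μ : Measure P}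

theorem integrable_apply_family {G : P → 𝓢(E, F)} (hG : Continuous G)
    (hi : ∀ k l, Integrable (fun p => SchwartzMap.seminorm ℝ k l (G p)) μ) (x : E) :
    Integrable (fun p => G p x) μ :=
  (hi 0 0).mono' (continuous_apply_family hG x).aestronglyMeasurable
    (Eventually.of_forall fun p => SchwartzMap.norm_le_seminorm ℝ (G p) x)

/-- Dominated differentiation: the $(0,1)$ seminorm of $G(p)$ bounds its derivative at all points
simultaneously, and it is integrable by assumption. -/
theorem hasFDerivAt_integral_family {G : P → 𝓢(E, F)} (hG : Continuous G)
    (hi : ∀ k l, Integrable (fun p => SchwartzMap.seminorm ℝ k l (G p)) μ) (x : E) :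
    HasFDerivAt (fun x => ∫ p, G p x ∂μ)
      (∫ p, SchwartzMap.fderivCLM ℝ E F (G p) x ∂μ) x := by
  refine hasFDerivAt_integral_of_dominated_of_fderiv_le (𝕜 := ℝ) (s := univ)
    (F' := fun y p => SchwartzMap.fderivCLM ℝ E F (G p) y)
    (bound := fun p => SchwartzMap.seminorm ℝ 0 1 (G p)) univ_mem
    (Eventually.of_forall fun y => (continuous_apply_family hG y).aestronglyMeasurable)
    (integrable_apply_family hG hi x) ?_ ?_ (hi 0 1) ?_
  · exact (continuous_apply_family
      ((SchwartzMap.fderivCLM ℝ E F).continuous.comp hG) x).aestronglyMeasurable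
  · exact Eventually.of_forall fun p y _ => (SchwartzMap.norm_le_seminorm ℝ _ y).trans
      (seminorm_fderivCLM_le 0 0 (G p))
  · exact Eventually.of_forall fun p y _ => (G p).hasFDerivAt y

/-- The derivatives of the $G(p)$ form a family of the same kind with values in $E\to F$, so the
induction runs over all target spaces at once. -/
theorem iteratedFDeriv_integral_family {G : P → 𝓢(E, F)} (hG : Continuous G)
    (hi : ∀ k l, Integrable (fun p => SchwartzMap.seminorm ℝ k l (G p)) μ) (n : ℕ) :
    ContDiff ℝ n (fun x => ∫ p, G p x ∂μ) ∧ ∀ x, iteratedFDeriv ℝ n (fun x => ∫ p, G p x ∂μ) x =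
      ∫ p, iteratedFDeriv ℝ n (G p) x ∂μ := by
  induction n generalizing F with
  | zero =>
    refine ⟨?_, fun x => ?_⟩
    · exact contDiff_zero.2 (continuous_iff_continuousAt.2 fun x =>
        (hasFDerivAt_integral_family hG hi x).continuousAt)
    · simp only [iteratedFDeriv_zero_eq_comp, Function.comp_apply]
      exact (ContinuousLinearEquiv.integral_comp_comm
        (continuousMultilinearCurryFin0 ℝ E F).symm.toContinuousLinearEquiv _).symm
  | succ n ih =>
    have hG' : Continuous fun p => SchwartzMap.fderivCLM ℝ E F (G p) :=
      (SchwartzMap.fderivCLM ℝ E F).continuous.comp hG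
    have hi' : ∀ k l, Integrable
        (fun p => SchwartzMap.seminorm ℝ k l (SchwartzMap.fderivCLM ℝ E F (G p))) μ := fun k l =>
      (hi k (l + 1)).mono' (continuous_seminorm_comp hG' k l).aestronglyMeasurable
        (Eventually.of_forall fun p => by
          rw [Real.norm_of_nonneg (apply_nonneg _ _)]
          exact seminorm_fderivCLM_le k l (G p))
    obtain ⟨h1, h2⟩ := ih hG' hi'
    have hd := hasFDerivAt_integral_family hG hi
    have hf : fderiv ℝ (fun x => ∫ p, G p x ∂μ) =
        fun x => ∫ p, SchwartzMap.fderivCLM ℝ E F (G p) x ∂μ := funext fun x => (hd x).fderiv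
    refine ⟨?_, fun x => ?_⟩
    · push_cast
      rw [contDiff_succ_iff_fderiv]
      refine ⟨fun x => (hd x).differentiableAt, by simp, ?_⟩
      rw [hf]; exact h1
    · simp only [iteratedFDeriv_succ_eq_comp_right, Function.comp_apply]
      rw [hf, h2]
      have e : ∀ p, ⇑(SchwartzMap.fderivCLM ℝ E F (G p)) = fderiv ℝ (G p) := fun p =>
        funext fun x => rfl
      simp only [e]
      exact (ContinuousLinearEquiv.integral_comp_comm (𝕜 := ℝ) (μ := μ)
        (E := E [×n]→L[ℝ] (E →L[ℝ] F)) (F := E [×(n + 1)]→L[ℝ] F)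
        (continuousMultilinearCurryRightEquiv' ℝ n E F).symm.toContinuousLinearEquiv _).symm

/-- The integral of a continuous family of Schwartz functions with integrable seminorms. -/
def integralFamily {G : P → 𝓢(E, F)} (hG : Continuous G)
    (hi : ∀ k l, Integrable (fun p => SchwartzMap.seminorm ℝ k l (G p)) μ) : 𝓢(E, F) where
  toFun x := ∫ p, G p x ∂μ
  smooth' := contDiff_infty.2 fun n => (iteratedFDeriv_integral_family hG hi n).1
  decay' k l := by
    refine ⟨∫ p, SchwartzMap.seminorm ℝ k l (G p) ∂μ, fun x => ?_⟩
    rw [(iteratedFDeriv_integral_family hG hi l).2, ← norm_norm x, ← norm_pow, ← norm_smul,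
      ← integral_smul]
    refine norm_integral_le_of_norm_le (hi k l) (Eventually.of_forall fun p => ?_)
    rw [norm_smul, norm_pow, norm_norm]
    exact SchwartzMap.le_seminorm ℝ k l (G p) x

end Families

/-! ### Interchange of tempered distributions and integrals -/

section Pettis

variable {E : Type} [NormedAddCommGroup E] [NormedSpace ℝ E]

/-- A continuous seminorm on the Schwartz space is dominated by a finite sum of the standard
seminorms. -/
theorem exists_bound_of_continuous_seminorm (q : Seminorm ℂ 𝓢(E, ℂ)) (hq : Continuous q) :
    ∃ (s : Finset (ℕ × ℕ)) (C : ℝ), 0 ≤ C ∧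
      ∀ φ, q φ ≤ C * ∑ i ∈ s, SchwartzMap.seminorm ℝ i.1 i.2 φ := by
  obtain ⟨s, C, -, h⟩ := Seminorm.bound_of_continuous (schwartz_withSeminorms ℂ E ℂ) q hq
  refine ⟨s, C, C.2, fun φ => (h φ).trans ?_⟩
  have h2 := Seminorm.finset_sup_le_sum (schwartzSeminormFamily ℂ E ℂ) s φ
  rw [smul_apply, NNReal.smul_def, smul_eq_mul]
  refine mul_le_mul_of_nonneg_left (h2.trans (le_of_eq ?_)) C.2
  rw [← FunLike.coeAddMonoidHom_apply, map_sum, Finset.sum_apply]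
  rfl

/-- The seminorm `φ ↦ |T φ|`. -/
def absSeminorm (T : StrongDual ℂ 𝓢(E, ℂ)) : Seminorm ℂ 𝓢(E, ℂ) :=
  (normSeminorm ℂ ℂ).comp T.toLinearMap

theorem exists_bound_dual (T : StrongDual ℂ 𝓢(E, ℂ)) :
    ∃ (s : Finset (ℕ × ℕ)) (C : ℝ), 0 ≤ C ∧
      ∀ φ, ‖T φ‖ ≤ C * ∑ i ∈ s, SchwartzMap.seminorm ℝ i.1 i.2 φ :=
  exists_bound_of_continuous_seminorm (absSeminorm T) T.continuous.norm

/-- The function `x ↦ |x|^k D^l φ(x)` as a bounded continuous function. -/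
def weightedDeriv (k l : ℕ) (φ : 𝓢(E, ℂ)) : BoundedContinuousFunction E (E [×l]→L[ℝ] ℂ) :=
  BoundedContinuousFunction.ofNormedAddCommGroup
    (fun x => ‖x‖ ^ k • iteratedFDeriv ℝ l φ x)
    ((continuous_norm.pow k).smul ((φ.smooth l).continuous_iteratedFDeriv le_rfl))
    (SchwartzMap.seminorm ℝ k l φ) (fun x => by
      rw [norm_smul, norm_pow, norm_norm]
      exact SchwartzMap.le_seminorm ℝ k l φ x)

theorem weightedDeriv_apply (k l : ℕ) (φ : 𝓢(E, ℂ)) (x : E) :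
    weightedDeriv k l φ x = ‖x‖ ^ k • iteratedFDeriv ℝ l φ x := rfl

theorem norm_weightedDeriv (k l : ℕ) (φ : 𝓢(E, ℂ)) :
    ‖weightedDeriv k l φ‖ = SchwartzMap.seminorm ℝ k l φ := by
  refine le_antisymm
    ((BoundedContinuousFunction.norm_le (apply_nonneg _ _)).2 fun x => ?_) ?_
  · rw [weightedDeriv_apply, norm_smul, norm_pow, norm_norm]
    exact SchwartzMap.le_seminorm ℝ k l φ x
  refine SchwartzMap.seminorm_le_bound ℝ k l φ (norm_nonneg (weightedDeriv k l φ)) fun x => ?_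
  have := (weightedDeriv k l φ).norm_coe_le_norm x
  rwa [weightedDeriv_apply, norm_smul, norm_pow, norm_norm] at this

/-- The map `φ ↦ |x|^k D^l φ` from the Schwartz space to bounded continuous functions. -/
def weightedDerivCLM (k l : ℕ) :
    𝓢(E, ℂ) →L[ℂ] BoundedContinuousFunction E (E [×l]→L[ℝ] ℂ) :=
  SchwartzMap.mkCLMtoNormedSpace (D := E) (E := ℂ) (σ := RingHom.id ℂ) (weightedDeriv k l)
    (fun φ χ => by
      ext1 x
      have : iteratedFDeriv ℝ l (⇑(φ + χ)) x =
          iteratedFDeriv ℝ l φ x + iteratedFDeriv ℝ l χ x :=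
        iteratedFDeriv_add_apply (φ.contDiffAt l) (χ.contDiffAt l)
      simp only [BoundedContinuousFunction.add_apply, weightedDeriv_apply, this, smul_add])
    (fun c φ => by
      ext1 x
      have : iteratedFDeriv ℝ l (⇑(c • φ)) x = c • iteratedFDeriv ℝ l φ x :=
        iteratedFDeriv_const_smul_apply (φ.contDiffAt l)
      rw [weightedDeriv_apply, this, smul_comm]
      rfl)
    ⟨{(k, l)}, 1, zero_le_one, fun φ => by
      rw [Finset.sup_singleton, one_mul]
      exact (norm_weightedDeriv k l φ).le⟩

theorem norm_weightedDerivCLM (k l : ℕ) (φ : 𝓢(E, ℂ)) :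
    ‖weightedDerivCLM k l φ‖ = SchwartzMap.seminorm ℝ k l φ := norm_weightedDeriv k l φ

/-- The Banach space of families of bounded continuous functions with values in the
`l`-linear maps, `(k, l) ∈ s`. -/
def DerivSpace (E : Type) [NormedAddCommGroup E] [NormedSpace ℝ E] (s : Finset (ℕ × ℕ)) : Type :=
  ∀ i : s, BoundedContinuousFunction E (E [×i.1.2]→L[ℝ] ℂ)

instance (s : Finset (ℕ × ℕ)) : NormedAddCommGroup (DerivSpace E s) :=
  inferInstanceAs (NormedAddCommGroup (∀ i : s, BoundedContinuousFunction E (E [×i.1.2]→L[ℝ] ℂ)))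

instance (s : Finset (ℕ × ℕ)) : NormedSpace ℂ (DerivSpace E s) :=
  inferInstanceAs (NormedSpace ℂ (∀ i : s, BoundedContinuousFunction E (E [×i.1.2]→L[ℝ] ℂ)))

instance (s : Finset (ℕ × ℕ)) : CompleteSpace (DerivSpace E s) :=
  inferInstanceAs (CompleteSpace (∀ i : s, BoundedContinuousFunction E (E [×i.1.2]→L[ℝ] ℂ)))

/-- Evaluation of a component of a family at a point. -/
def DerivSpace.eval {s : Finset (ℕ × ℕ)} (i : s) (x : E) :
    DerivSpace E s →L[ℂ] (E [×i.1.2]→L[ℝ] ℂ) :=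
  LinearMap.mkContinuous
    { toFun := fun g => g i x
      map_add' := fun _ _ => rfl
      map_smul' := fun _ _ => rfl } 1 (fun g => by
        rw [one_mul]
        exact ((g i).norm_coe_le_norm x).trans (norm_le_pi_norm
          (G := fun i : s => BoundedContinuousFunction E (E [×i.1.2]→L[ℝ] ℂ)) g i))

/-- The embedding `φ ↦ (|x|^k D^l φ)`, `(k, l) ∈ s`, into a Banach space. -/
def weightedDerivs (s : Finset (ℕ × ℕ)) : 𝓢(E, ℂ) →L[ℂ] DerivSpace E s where
  toFun φ := fun i => weightedDerivCLM i.1.1 i.1.2 φ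
  map_add' φ χ := funext fun i => map_add (weightedDerivCLM i.1.1 i.1.2) φ χ
  map_smul' c φ := funext fun i => map_smul (weightedDerivCLM i.1.1 i.1.2) c φ
  cont := continuous_pi fun i => (weightedDerivCLM i.1.1 i.1.2).continuous

theorem norm_weightedDerivs_le (s : Finset (ℕ × ℕ)) (φ : 𝓢(E, ℂ)) :
    ‖weightedDerivs s φ‖ ≤ ∑ i ∈ s, SchwartzMap.seminorm ℝ i.1 i.2 φ := by
  refine (pi_norm_le_iff_of_nonneg (Finset.sum_nonneg fun i _ => apply_nonneg _ _)).2 fun i => ?_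
  refine (norm_weightedDerivCLM i.1.1 i.1.2 φ).le.trans ?_
  exact Finset.single_le_sum (f := fun i : ℕ × ℕ => SchwartzMap.seminorm ℝ i.1 i.2 φ)
    (fun i _ => apply_nonneg _ _) i.2

theorem seminorm_le_norm_weightedDerivs (s : Finset (ℕ × ℕ)) (φ : 𝓢(E, ℂ)) {i : ℕ × ℕ}
    (hi : i ∈ s) : SchwartzMap.seminorm ℝ i.1 i.2 φ ≤ ‖weightedDerivs s φ‖ := by
  rw [← norm_weightedDerivCLM]
  exact norm_le_pi_norm (fun i : s => weightedDerivCLM i.1.1 i.1.2 φ) ⟨i, hi⟩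

/-- A functional that is bounded with respect to an operator into a normed space factors
through that operator. -/
theorem exists_factorization {V X : Type*} [AddCommGroup V] [Module ℂ V]
    [NormedAddCommGroup X] [NormedSpace ℂ X] (T : V →ₗ[ℂ] ℂ) (A : V →ₗ[ℂ] X) (C : ℝ)
    (h : ∀ v, ‖T v‖ ≤ C * ‖A v‖) : ∃ S : X →L[ℂ] ℂ, ∀ v, S (A v) = T v := by
  have hker : LinearMap.ker A ≤ LinearMap.ker T := fun v hv => by
    have := h v
    rw [LinearMap.mem_ker.1 hv] at this
    simpa using this
  -- The functional descends to $V/\ker A\cong\operatorname{range}A$, is bounded there by the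
  -- hypothesis, and extends to $X$ by Hahn–Banach.
  let T₀ : LinearMap.range A →ₗ[ℂ] ℂ :=
    ((LinearMap.ker A).liftQ T hker) ∘ₗ A.quotKerEquivRange.symm.toLinearMap
  have hT₀ : ∀ v, T₀ ⟨A v, LinearMap.mem_range_self A v⟩ = T v := fun v => by
    have e : A.quotKerEquivRange.symm ⟨A v, LinearMap.mem_range_self A v⟩ =
        (LinearMap.ker A).mkQ v := by
      rw [LinearEquiv.symm_apply_eq]; rfl
    simp only [T₀, LinearMap.comp_apply, LinearEquiv.coe_coe, e]
    rfl
  let T₁ : LinearMap.range A →L[ℂ] ℂ := T₀.mkContinuous C (by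
    rintro ⟨_, v, rfl⟩
    rw [hT₀]
    exact h v)
  obtain ⟨S, hS, -⟩ := exists_extension_norm_eq (LinearMap.range A) T₁
  exact ⟨S, fun v => (hS ⟨A v, LinearMap.mem_range_self A v⟩).trans (hT₀ v)⟩

variable {P : Type*} [TopologicalSpace P]
  [MeasurableSpace P] [OpensMeasurableSpace P] {μ : Measure P}

theorem integrable_dual_family {G : P → 𝓢(E, ℂ)} (hG : Continuous G)
    (hi : ∀ k l, Integrable (fun p => SchwartzMap.seminorm ℝ k l (G p)) μ)
    (T : StrongDual ℂ 𝓢(E, ℂ)) : Integrable (fun p => T (G p)) μ := by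
  obtain ⟨s, C, -, hC⟩ := exists_bound_dual T
  exact ((integrable_finsetSum s fun i _ => hi i.1 i.2).const_mul C).mono'
    (T.continuous.comp hG).aestronglyMeasurable (Eventually.of_forall fun p => hC (G p))

variable [SecondCountableTopology P]

/-- Tempered distributions commute with the integral of a family of Schwartz functions. -/
theorem dual_integralFamily {G : P → 𝓢(E, ℂ)} (hG : Continuous G)
    (hi : ∀ k l, Integrable (fun p => SchwartzMap.seminorm ℝ k l (G p)) μ)
    (T : StrongDual ℂ 𝓢(E, ℂ)) : T (integralFamily hG hi) = ∫ p, T (G p) ∂μ := by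
  obtain ⟨s, C, hC0, hC⟩ := exists_bound_dual T
  -- The factor `s.card` comes from replacing the sum of the seminorms by the sup norm of the
  -- product space.
  have hb : ∀ φ, ‖T φ‖ ≤ C * s.card * ‖weightedDerivs s φ‖ := fun φ => by
    refine (hC φ).trans ?_
    rw [mul_assoc]
    refine mul_le_mul_of_nonneg_left ?_ hC0
    rw [← nsmul_eq_mul]
    refine Finset.sum_le_card_nsmul _ _ _ fun i hi => ?_
    exact seminorm_le_norm_weightedDerivs s φ hi
  obtain ⟨S, hS⟩ := exists_factorization T.toLinearMap
    (weightedDerivs s).toLinearMap (C * s.card) hb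
  have hS' : ∀ φ, S (weightedDerivs s φ) = T φ := hS
  have hint : Integrable (fun p => weightedDerivs s (G p)) μ := by
    refine (integrable_finsetSum s fun i _ => hi i.1 i.2).mono'
      ((weightedDerivs s).continuous.comp hG).aestronglyMeasurable
      (Eventually.of_forall fun p => norm_weightedDerivs_le s (G p))
  -- Evaluations of components at points are continuous and separate the elements of `DerivSpace`,
  -- so the identity reduces to differentiation under the integral.
  have key : weightedDerivs s (integralFamily hG hi) = ∫ p, weightedDerivs s (G p) ∂μ := by
    funext i
    ext1 x
    have h1 := (DerivSpace.eval i x).integral_comp_comm hint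
    refine Eq.trans ?_ h1
    change ‖x‖ ^ i.1.1 • iteratedFDeriv ℝ i.1.2 (fun x => ∫ p, G p x ∂μ) x =
      ∫ p, ‖x‖ ^ i.1.1 • iteratedFDeriv ℝ i.1.2 (G p) x ∂μ
    rw [(iteratedFDeriv_integral_family hG hi i.1.2).2, integral_smul]
  rw [← hS', key, ← S.integral_comp_comm hint]
  simp only [hS']

end Pettis

/-! ### Functions dominated by continuous seminorms -/

section Dominated

variable {V : Type*} [AddCommGroup V] [Module ℂ V] [TopologicalSpace V]

/-- The function `q` is dominated by a continuous seminorm. -/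
def Dominated (q : V → ℝ) : Prop := ∃ Q : Seminorm ℂ V, Continuous Q ∧ ∀ v, q v ≤ Q v

theorem Dominated.of_continuous (Q : Seminorm ℂ V) (hQ : Continuous Q) : Dominated Q :=
  ⟨Q, hQ, fun _ => le_rfl⟩

theorem Dominated.add {q q' : V → ℝ} (h : Dominated q) (h' : Dominated q') :
    Dominated fun v => q v + q' v := by
  obtain ⟨Q, hQ, h⟩ := h
  obtain ⟨Q', hQ', h'⟩ := h'
  exact ⟨Q + Q', hQ.add hQ', fun v => add_le_add (h v) (h' v)⟩

theorem Dominated.const_mul {q : V → ℝ} (h : Dominated q) {c : ℝ} (hc : 0 ≤ c) :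
    Dominated fun v => c * q v := by
  obtain ⟨Q, hQ, h⟩ := h
  exact ⟨NNReal.mk c hc • Q, hQ.const_smul c, fun v => mul_le_mul_of_nonneg_left (h v) hc⟩

theorem Dominated.sum {ι : Type*} (s : Finset ι) {q : ι → V → ℝ} (h : ∀ i ∈ s, Dominated (q i)) :
    Dominated fun v => ∑ i ∈ s, q i v := by
  classical
  induction s using Finset.induction_on with
  | empty => exact ⟨0, continuous_zero, fun v => by simp⟩
  | insert a s ha ih =>
    simp only [Finset.sum_insert ha]
    exact (h a (Finset.mem_insert_self a s)).add
      (ih fun i hi => h i (Finset.mem_insert_of_mem hi))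

theorem Dominated.comp {W : Type*} [AddCommGroup W] [Module ℂ W] [TopologicalSpace W]
    {q : V → ℝ} (h : Dominated q) (L : W →L[ℂ] V) : Dominated fun w => q (L w) := by
  obtain ⟨Q, hQ, h⟩ := h
  exact ⟨Q.comp L.toLinearMap, hQ.comp L.continuous, fun w => h (L w)⟩

theorem dominated_seminorm {E : Type} [NormedAddCommGroup E] [NormedSpace ℝ E] (k l : ℕ) :
    Dominated (V := 𝓢(E, ℂ)) fun φ => SchwartzMap.seminorm ℝ k l φ :=
  ⟨SchwartzMap.seminorm ℂ k l,
    (schwartz_withSeminorms ℂ E ℂ).continuous_seminorm (k, l), fun _ => le_rfl⟩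

end Dominated

/-! ### Multiplication by ridge functions -/

section Ridge

variable {d : ℕ}

/-- The ridge function `x ↦ χ(x · v - b)`, `p = (v, b)`. -/
def ridge (χ : 𝓢(ℝ, ℂ)) (p : Rn d × ℝ) (x : Rn d) : ℂ := χ (⟪x, p.1⟫_ℝ - p.2)

theorem hasTemperateGrowth_ridge (χ : 𝓢(ℝ, ℂ)) (p : Rn d × ℝ) :
    Function.HasTemperateGrowth (ridge χ p) :=
  χ.hasTemperateGrowth.comp
    ((Function.hasTemperateGrowth_inner_left p.1).sub (Function.HasTemperateGrowth.const p.2))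

/-- Multiplication by a ridge function. -/
def ridgeCLM (χ : 𝓢(ℝ, ℂ)) (p : Rn d × ℝ) : 𝓢(Rn d, ℂ) →L[ℂ] 𝓢(Rn d, ℂ) :=
  SchwartzMap.smulLeftCLM ℂ (ridge χ p)

theorem ridgeCLM_apply (χ : 𝓢(ℝ, ℂ)) (p : Rn d × ℝ) (φ : 𝓢(Rn d, ℂ)) (x : Rn d) :
    ridgeCLM χ p φ x = χ (⟪x, p.1⟫_ℝ - p.2) * φ x := by
  rw [ridgeCLM, SchwartzMap.smulLeftCLM_apply_apply (hasTemperateGrowth_ridge χ p), smul_eq_mul,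
    ridge]

/-- A ridge function is a translate of $\chi$ composed with a linear form of norm $|v|$. The
translation by $b$ does not affect sup norms, which is the source of all uniformity in $b$. -/
theorem norm_iteratedFDeriv_ridge_le (χ : 𝓢(ℝ, ℂ)) (p : Rn d × ℝ) (j : ℕ) (x : Rn d) :
    ‖iteratedFDeriv ℝ j (ridge χ p) x‖ ≤ SchwartzMap.seminorm ℝ 0 j χ * ‖p.1‖ ^ j := by
  have e : ridge χ p = (fun t => χ (t - p.2)) ∘ innerSL ℝ p.1 := by
    funext x
    simp [ridge, real_inner_comm]
  have hs : ContDiff ℝ j (fun t => χ (t - p.2)) := (χ.smooth j).comp (by fun_prop)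
  rw [e, (innerSL ℝ p.1).iteratedFDeriv_comp_right hs x le_rfl]
  refine (ContinuousMultilinearMap.norm_compContinuousLinearMap_le _ _).trans ?_
  rw [Finset.prod_const, Finset.card_univ, Fintype.card_fin, innerSL_apply_norm,
    iteratedFDeriv_comp_sub]
  exact mul_le_mul_of_nonneg_right (SchwartzMap.norm_iteratedFDeriv_le_seminorm ℝ χ j _)
    (by positivity)

/-- Leibniz rule, with the weight $|x|^k$ given entirely to $\varphi$, since the ridge function only
has bounded derivatives. -/
theorem seminorm_ridgeCLM_le (χ : 𝓢(ℝ, ℂ)) {R : ℝ} {p : Rn d × ℝ} (hp : ‖p.1‖ ≤ R)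
    (k l : ℕ) (φ : 𝓢(Rn d, ℂ)) :
    SchwartzMap.seminorm ℝ k l (ridgeCLM χ p φ) ≤ ∑ j ∈ Finset.range (l + 1),
      (l.choose j * (SchwartzMap.seminorm ℝ 0 j χ * R ^ j)) *
        SchwartzMap.seminorm ℝ k (l - j) φ := by
  have hR : 0 ≤ R := (norm_nonneg _).trans hp
  refine SchwartzMap.seminorm_le_bound ℝ k l _ (Finset.sum_nonneg fun j _ => by positivity)
    fun x => ?_
  have e : ⇑(ridgeCLM χ p φ) = fun x => ridge χ p x * φ x := by
    funext x; exact ridgeCLM_apply χ p φ x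
  rw [e]
  refine (mul_le_mul_of_nonneg_left (norm_iteratedFDeriv_mul_le
    ((hasTemperateGrowth_ridge χ p).1) (φ.smooth ⊤) x (natCast_le_infty l))
    (by positivity)).trans ?_
  rw [Finset.mul_sum]
  refine Finset.sum_le_sum fun j _ => ?_
  have h1 : ‖iteratedFDeriv ℝ j (ridge χ p) x‖ ≤ SchwartzMap.seminorm ℝ 0 j χ * R ^ j :=
    (norm_iteratedFDeriv_ridge_le χ p j x).trans (by gcongr)
  have h2 := SchwartzMap.le_seminorm ℝ k (l - j) φ x
  calc _ = (l.choose j * ‖iteratedFDeriv ℝ j (ridge χ p) x‖) *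
        (‖x‖ ^ k * ‖iteratedFDeriv ℝ (l - j) φ x‖) := by ring
    _ ≤ _ := by gcongr

/-- Multiplication by ridge functions is equicontinuous as long as the directions are bounded. -/
theorem dominated_seminorm_ridgeCLM (χ : 𝓢(ℝ, ℂ)) (R : ℝ) (k l : ℕ) :
    ∃ Q : Seminorm ℂ 𝓢(Rn d, ℂ), Continuous Q ∧ ∀ p : Rn d × ℝ, ‖p.1‖ ≤ R → ∀ φ,
      SchwartzMap.seminorm ℝ k l (ridgeCLM χ p φ) ≤ Q φ := by
  by_cases hR : 0 ≤ R
  · obtain ⟨Q, hQ, h⟩ : Dominated (V := 𝓢(Rn d, ℂ)) fun φ => ∑ j ∈ Finset.range (l + 1),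
        (l.choose j * (SchwartzMap.seminorm ℝ 0 j χ * R ^ j)) *
          SchwartzMap.seminorm ℝ k (l - j) φ :=
      Dominated.sum _ fun j _ => (dominated_seminorm k (l - j)).const_mul (by positivity)
    exact ⟨Q, hQ, fun p hp φ => (seminorm_ridgeCLM_le χ hp k l φ).trans (h φ)⟩
  · exact ⟨0, continuous_zero, fun p hp => absurd ((norm_nonneg _).trans hp) hR⟩

theorem dominated_dual_ridgeCLM (T : TD d) (χ : 𝓢(ℝ, ℂ)) (R : ℝ) :
    ∃ Q : Seminorm ℂ 𝓢(Rn d, ℂ), Continuous Q ∧ ∀ p : Rn d × ℝ, ‖p.1‖ ≤ R → ∀ φ,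
      ‖T (ridgeCLM χ p φ)‖ ≤ Q φ := by
  obtain ⟨s, C, hC0, hC⟩ := exists_bound_dual T
  choose q hq h using fun i : ℕ × ℕ => dominated_seminorm_ridgeCLM (d := d) χ R i.1 i.2
  obtain ⟨Q, hQ, h'⟩ : Dominated (V := 𝓢(Rn d, ℂ)) fun φ => C * ∑ i ∈ s, q i φ :=
    (Dominated.sum s fun i _ => Dominated.of_continuous (q i) (hq i)).const_mul hC0
  refine ⟨Q, hQ, fun p hp φ => (hC _).trans (le_trans ?_ (h' φ))⟩
  exact mul_le_mul_of_nonneg_left (Finset.sum_le_sum fun i _ => h i p hp φ) hC0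

/-- The product is jointly smooth in $(v,b,x)$, and its seminorms are bounded on $|v|\le|v_0|+1$ by
equicontinuity. -/
theorem continuous_ridgeCLM_apply (χ : 𝓢(ℝ, ℂ)) (φ : 𝓢(Rn d, ℂ)) :
    Continuous fun p : Rn d × ℝ => ridgeCLM χ p φ := by
  refine continuous_of_continuous_iteratedFDeriv (fun l => ?_) fun k l p₀ => ?_
  · have hsm : ContDiff ℝ ∞
        fun q : (Rn d × ℝ) × Rn d => χ (⟪q.2, q.1.1⟫_ℝ - q.1.2) * φ q.2 :=
      ((χ.smooth ⊤).comp ((contDiff_snd.inner ℝ contDiff_fst.fst).sub contDiff_fst.snd)).mul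
        ((φ.smooth ⊤).comp contDiff_snd)
    rw [continuous_iff_continuousAt]
    intro q
    have := contDiffAt_iteratedFDeriv_snd (U := univ) (fun q _ => hsm.contDiffAt) l q (mem_univ _)
    have h2 := this.continuousAt
    refine h2.congr (Eventually.of_forall fun q => ?_)
    have e : ⇑(ridgeCLM χ q.1 φ) = fun x => χ (⟪x, q.1.1⟫_ℝ - q.1.2) * φ x := by
      funext x; exact ridgeCLM_apply χ q.1 φ x
    simp only [e]
  · obtain ⟨Q, -, hQ⟩ := dominated_seminorm_ridgeCLM (d := d) χ (‖p₀.1‖ + 1) k l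
    refine ⟨Q φ, ?_⟩
    have h1 : Continuous fun p : Rn d × ℝ => ‖p.1‖ := by fun_prop
    filter_upwards [h1.continuousAt.eventually_lt_const (lt_add_one ‖p₀.1‖)] with p hp
    exact hQ p hp.le φ

theorem continuous_ridgeCLM_family {P : Type*} [TopologicalSpace P] (χ : 𝓢(ℝ, ℂ))
    {γ : P → Rn d × ℝ} (hγ : Continuous γ) {Φ : P → 𝓢(Rn d, ℂ)} (hΦ : Continuous Φ) :
    Continuous fun p => ridgeCLM χ (γ p) (Φ p) := by
  rw [continuous_iff_continuousAt]
  intro p₀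
  -- Split $\Phi(p)=\Phi(p_0)+(\Phi(p)-\Phi(p_0))$: the first part uses continuity for a fixed
  -- function, the second uses equicontinuity.
  have h1 : Tendsto (fun p => ridgeCLM χ (γ p) (Φ p₀)) (𝓝 p₀)
      (𝓝 (ridgeCLM χ (γ p₀) (Φ p₀))) :=
    ((continuous_ridgeCLM_apply χ (Φ p₀)).comp hγ).tendsto p₀
  have h2 : Tendsto (fun p => ridgeCLM χ (γ p) (Φ p - Φ p₀)) (𝓝 p₀) (𝓝 0) := by
    rw [(schwartz_withSeminorms ℝ (Rn d) ℂ).tendsto_nhds]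
    rintro ⟨k, l⟩ ε hε
    obtain ⟨Q, hQc, hQ⟩ := dominated_seminorm_ridgeCLM (d := d) χ (‖(γ p₀).1‖ + 1) k l
    have h3 : Continuous fun p : P => ‖(γ p).1‖ := by fun_prop
    have h4 : Continuous fun p => Q (Φ p - Φ p₀) := hQc.comp (hΦ.sub continuous_const)
    have h5 := h4.tendsto p₀
    rw [sub_self, map_zero] at h5
    filter_upwards [h3.continuousAt.eventually_lt_const (lt_add_one ‖(γ p₀).1‖),
      h5.eventually_lt_const hε] with p hp hp'
    rw [sub_zero]
    exact (hQ (γ p) hp.le _).trans_lt hp'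
  have h3 := h2.add h1
  rw [zero_add] at h3
  refine h3.congr fun p => ?_
  rw [← map_add, sub_add_cancel]

/-- Multiplication by the coordinate `x_i`. -/
def coordCLM (i : Fin (d + 1)) : 𝓢(Rn d, ℂ) →L[ℂ] 𝓢(Rn d, ℂ) :=
  SchwartzMap.smulLeftCLM ℂ (fun x : Rn d => (x i : ℂ))

theorem coordCLM_apply (i : Fin (d + 1)) (φ : 𝓢(Rn d, ℂ)) (x : Rn d) :
    coordCLM i φ x = (x i : ℂ) * φ x := by
  rw [coordCLM, SchwartzMap.smulLeftCLM_apply_apply, smul_eq_mul]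
  exact (Complex.ofRealCLM.hasTemperateGrowth).comp (hasTemperateGrowth_coord i)

/-- Multiplication by the affine function `x ↦ x · w - c`, `h = (w, c)`. -/
def affineCLM (h : Rn d × ℝ) : 𝓢(Rn d, ℂ) →L[ℂ] 𝓢(Rn d, ℂ) :=
  ∑ i, (h.1 i : ℂ) • coordCLM i - (h.2 : ℂ) • ContinuousLinearMap.id ℂ 𝓢(Rn d, ℂ)

theorem affineCLM_eq (h : Rn d × ℝ) (φ : 𝓢(Rn d, ℂ)) :
    affineCLM h φ = ∑ i, (h.1 i : ℂ) • coordCLM i φ - (h.2 : ℂ) • φ := by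
  simp [affineCLM]

theorem schwartz_sum_apply {ι : Type*} (s : Finset ι) (φ : ι → 𝓢(Rn d, ℂ)) (x : Rn d) :
    (∑ i ∈ s, φ i) x = ∑ i ∈ s, φ i x :=
  map_sum ((BoundedContinuousFunction.evalCLM ℝ x).comp
    (SchwartzMap.toBoundedContinuousFunctionCLM ℝ (Rn d) ℂ)) φ s

theorem affineCLM_apply (h : Rn d × ℝ) (φ : 𝓢(Rn d, ℂ)) (x : Rn d) :
    affineCLM h φ x = ((⟪x, h.1⟫_ℝ - h.2 : ℝ) : ℂ) * φ x := by
  rw [affineCLM_eq]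
  change (∑ i, (h.1 i : ℂ) • coordCLM i φ) x - (h.2 : ℂ) * φ x = _
  rw [schwartz_sum_apply, PiLp.inner_apply]
  simp only [smul_apply, coordCLM_apply, smul_eq_mul, RCLike.inner_apply, conj_trivial]
  push_cast
  rw [sub_mul, Finset.sum_mul]
  simp only [mul_assoc]

/-- The operator is linear in $h$ with finitely many fixed coefficient operators; the factor $\|h\|$
supplies the powers of $\|h\|$ in the Lipschitz and Taylor estimates. -/
theorem dominated_affineCLM (Q : Seminorm ℂ 𝓢(Rn d, ℂ)) (hQ : Continuous Q) :
    ∃ Q' : Seminorm ℂ 𝓢(Rn d, ℂ), Continuous Q' ∧ ∀ h φ, Q (affineCLM h φ) ≤ ‖h‖ * Q' φ := by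
  obtain ⟨Q', hQ', hh⟩ : Dominated (V := 𝓢(Rn d, ℂ)) fun φ => ∑ i, Q (coordCLM i φ) + Q φ :=
    (Dominated.sum _ fun i _ => (Dominated.of_continuous Q hQ).comp (coordCLM i)).add
      (Dominated.of_continuous Q hQ)
  refine ⟨Q', hQ', fun h φ => ?_⟩
  refine le_trans ?_ (mul_le_mul_of_nonneg_left (hh φ) (norm_nonneg h))
  rw [affineCLM_eq, mul_add, Finset.mul_sum]
  refine (map_sub_le_add Q _ _).trans (add_le_add ?_ ?_)
  · refine (Finset.le_sum_of_subadditive Q (map_zero Q).le (map_add_le_add Q) _ _).trans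
      (Finset.sum_le_sum fun i _ => ?_)
    rw [map_smul_eq_mul, Complex.norm_real]
    exact mul_le_mul_of_nonneg_right ((PiLp.norm_apply_le h.1 i).trans (norm_fst_le h))
      (apply_nonneg _ _)
  · rw [map_smul_eq_mul, Complex.norm_real]
    exact mul_le_mul_of_nonneg_right (norm_snd_le h) (apply_nonneg _ _)

/-- The fundamental theorem of calculus along the segment from `p` to `p + h`. -/
theorem dual_ridgeCLM_sub (T : TD d) (χ : 𝓢(ℝ, ℂ)) (p h : Rn d × ℝ) (φ : 𝓢(Rn d, ℂ)) :
    T (ridgeCLM χ (p + h) φ) - T (ridgeCLM χ p φ) =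
      ∫ s in (0 : ℝ)..1, T (ridgeCLM (SchwartzMap.derivCLM ℂ ℂ χ) (p + s • h) (affineCLM h φ)) := by
  set G : ℝ → 𝓢(Rn d, ℂ) :=
    fun s => ridgeCLM (SchwartzMap.derivCLM ℂ ℂ χ) (p + s • h) (affineCLM h φ) with hGdef
  have hG : Continuous G := continuous_ridgeCLM_family _ (by fun_prop) continuous_const
  have hi : ∀ k l, Integrable (fun s => SchwartzMap.seminorm ℝ k l (G s))
      (volume.restrict (Ioc (0 : ℝ) 1)) := fun k l =>
    (continuous_seminorm_comp hG k l).integrableOn_Ioc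
  -- The identity between Schwartz functions is the scalar fundamental theorem of calculus at each
  -- $x$; $T$ is applied only afterwards, under the integral.
  have e : ridgeCLM χ (p + h) φ - ridgeCLM χ p φ = integralFamily hG hi := by
    ext x
    change ridgeCLM χ (p + h) φ x - ridgeCLM χ p φ x = ∫ s in Ioc (0 : ℝ) 1, G s x
    rw [← intervalIntegral.integral_of_le zero_le_one]
    have hd : ∀ s : ℝ, HasDerivAt (fun s : ℝ => ridgeCLM χ (p + s • h) φ x) (G s x) s := by
      intro s
      have h1 : HasDerivAt (fun s : ℝ => ⟪x, (p + s • h).1⟫_ℝ - (p + s • h).2)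
          (⟪x, h.1⟫_ℝ - h.2) s := by
        have e1 : (fun s : ℝ => ⟪x, (p + s • h).1⟫_ℝ - (p + s • h).2) =
            fun s => (⟪x, p.1⟫_ℝ - p.2) + s * (⟪x, h.1⟫_ℝ - h.2) := by
          funext s
          simp only [Prod.fst_add, Prod.snd_add, Prod.smul_fst, Prod.smul_snd, inner_add_right,
            inner_smul_right, smul_eq_mul]
          ring
        rw [e1]
        simpa using ((hasDerivAt_id s).mul_const (⟪x, h.1⟫_ℝ - h.2)).const_add (⟪x, p.1⟫_ℝ - p.2)
      have h2 := ((χ.hasDerivAt (⟪x, (p + s • h).1⟫_ℝ - (p + s • h).2)).scomp s h1).mul_const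
        (φ x)
      simp only [ridgeCLM_apply, hGdef, affineCLM_apply, SchwartzMap.derivCLM_apply]
      refine h2.congr_deriv ?_
      rw [Complex.real_smul]
      ring
    rw [intervalIntegral.integral_eq_sub_of_hasDerivAt (fun s _ => hd s)
      ((continuous_apply_family hG x).intervalIntegrable 0 1)]
    simp
  rw [← map_sub, e, dual_integralFamily, intervalIntegral.integral_of_le zero_le_one]

/-- Convexity of the ball: segments between points of the sphere leave the sphere but stay where the
ridge estimates are uniform. This is why the estimates are stated for $|v|\le1$. -/
theorem norm_fst_segment_le {p h : Rn d × ℝ} (hp : ‖p.1‖ ≤ 1) (hph : ‖(p + h).1‖ ≤ 1) {s : ℝ}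
    (hs : s ∈ Icc (0 : ℝ) 1) : ‖(p + s • h).1‖ ≤ 1 := by
  have h1 := (convex_closedBall (0 : Rn d) 1).add_smul_mem (x := p.1) (y := h.1)
    (by simpa using hp) (by simpa using hph) hs
  simpa using h1

/-- The functionals `φ ↦ T(χ(· · v - b) φ)` depend in a Lipschitz continuous way on `(v, b)`,
`|v| ≤ 1`. -/
theorem dominated_ridgeCLM_lipschitz (T : TD d) (χ : 𝓢(ℝ, ℂ)) :
    ∃ Q : Seminorm ℂ 𝓢(Rn d, ℂ), Continuous Q ∧ ∀ p h : Rn d × ℝ, ‖p.1‖ ≤ 1 →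
      ‖(p + h).1‖ ≤ 1 → ∀ φ,
        ‖T (ridgeCLM χ (p + h) φ) - T (ridgeCLM χ p φ)‖ ≤ ‖h‖ * Q φ := by
  obtain ⟨Q₁, hQ₁, h1⟩ := dominated_dual_ridgeCLM T (SchwartzMap.derivCLM ℂ ℂ χ) 1
  obtain ⟨Q₂, hQ₂, h2⟩ := dominated_affineCLM Q₁ hQ₁
  refine ⟨Q₂, hQ₂, fun p h hp hph φ => ?_⟩
  rw [dual_ridgeCLM_sub]
  refine (intervalIntegral.norm_integral_le_of_norm_le_const (C := ‖h‖ * Q₂ φ)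
    fun s hs => ?_).trans (by simp)
  rw [uIoc_of_le zero_le_one] at hs
  exact (h1 _ (norm_fst_segment_le hp hph (Ioc_subset_Icc_self hs)) _).trans (h2 h φ)

/-- The remainder is the mean over the segment of the increments of the derivative. One factor
$\|h\|$ comes from the Lipschitz estimate for $\chi'$, the other from the affine multiplier. -/
theorem dominated_ridgeCLM_taylor (T : TD d) (χ : 𝓢(ℝ, ℂ)) :
    ∃ Q : Seminorm ℂ 𝓢(Rn d, ℂ), Continuous Q ∧ ∀ p h : Rn d × ℝ, ‖p.1‖ ≤ 1 →
      ‖(p + h).1‖ ≤ 1 → ∀ φ,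
        ‖T (ridgeCLM χ (p + h) φ) - T (ridgeCLM χ p φ) -
          T (ridgeCLM (SchwartzMap.derivCLM ℂ ℂ χ) p (affineCLM h φ))‖ ≤ ‖h‖ ^ 2 * Q φ := by
  obtain ⟨Q₁, hQ₁, h1⟩ := dominated_ridgeCLM_lipschitz T (SchwartzMap.derivCLM ℂ ℂ χ)
  obtain ⟨Q₂, hQ₂, h2⟩ := dominated_affineCLM Q₁ hQ₁
  refine ⟨Q₂, hQ₂, fun p h hp hph φ => ?_⟩
  have hc : Continuous fun s : ℝ =>
      T (ridgeCLM (SchwartzMap.derivCLM ℂ ℂ χ) (p + s • h) (affineCLM h φ)) :=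
    T.continuous.comp (continuous_ridgeCLM_family _ (by fun_prop) continuous_const)
  have e : T (ridgeCLM (SchwartzMap.derivCLM ℂ ℂ χ) p (affineCLM h φ)) =
      ∫ _s in (0 : ℝ)..1, T (ridgeCLM (SchwartzMap.derivCLM ℂ ℂ χ) p (affineCLM h φ)) := by simp
  rw [dual_ridgeCLM_sub, e,
    ← intervalIntegral.integral_sub (hc.intervalIntegrable 0 1) intervalIntegrable_const]
  refine (intervalIntegral.norm_integral_le_of_norm_le_const (C := ‖h‖ ^ 2 * Q₂ φ)
    fun s hs => ?_).trans (by simp)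
  rw [uIoc_of_le zero_le_one] at hs
  have h3 := h1 p (s • h) hp (norm_fst_segment_le hp hph (Ioc_subset_Icc_self hs)) (affineCLM h φ)
  have h4 : ‖s • h‖ ≤ ‖h‖ := by
    rw [norm_smul, Real.norm_of_nonneg hs.1.le]
    exact mul_le_of_le_one_left (norm_nonneg h) hs.2
  calc _ ≤ ‖s • h‖ * Q₁ (affineCLM h φ) := h3
    _ ≤ ‖h‖ * (‖h‖ * Q₂ φ) := mul_le_mul h4 (h2 h φ) (apply_nonneg _ _) (norm_nonneg _)
    _ = ‖h‖ ^ 2 * Q₂ φ := by ring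

end Ridge

/-! ### The strong topology of `𝓢'(ℝⁿ)` -/

section Strong

variable {d : ℕ}

/-- Every neighbourhood of zero in `𝓢'(ℝⁿ)` contains the functionals dominated by a small multiple
of a given continuous seminorm. -/
theorem exists_pos_mem_of_dominated {U : Set (TD d)} (hU : U ∈ 𝓝 (0 : TD d))
    (Q : Seminorm ℂ 𝓢(Rn d, ℂ)) (hQ : Continuous Q) :
    ∃ c > 0, ∀ T : TD d, (∀ φ, ‖T φ‖ ≤ c * Q φ) → T ∈ U := by
  obtain ⟨⟨S, V⟩, ⟨hS, hV⟩, hSV⟩ :=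
    (ContinuousLinearMap.hasBasis_nhds_zero (σ := RingHom.id ℂ)
      (E := 𝓢(Rn d, ℂ)) (F := ℂ)).mem_iff.1 hU
  -- The unit ball of $Q$ absorbs the bounded set $S$, so $Q<M$ on $S$, and $c=r/M$ makes $|T|<r$ on
  -- $S$.
  have hball : Q.ball 0 1 ∈ 𝓝 (0 : 𝓢(Rn d, ℂ)) := Q.ball_mem_nhds hQ one_pos
  obtain ⟨M, hM, hMS⟩ := (hS hball).exists_pos
  obtain ⟨r, hr, hrV⟩ := Metric.mem_nhds_iff.1 hV
  have hb : ∀ φ ∈ S, Q φ < M := fun φ hφ => by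
    have hn : ‖(M : ℂ)‖ = M := by rw [Complex.norm_real, Real.norm_of_nonneg hM.le]
    obtain ⟨χ, hχ, rfl⟩ := hMS (M : ℂ) hn.ge hφ
    rw [map_smul_eq_mul, hn]
    rw [Seminorm.mem_ball_zero] at hχ
    exact mul_lt_of_lt_one_right hM hχ
  refine ⟨r / M, by positivity, fun T hT => hSV fun φ hφ => hrV ?_⟩
  rw [mem_ball_zero_iff]
  refine (hT φ).trans_lt ?_
  rw [div_mul_eq_mul_div, div_lt_iff₀ hM]
  exact mul_lt_mul_of_pos_left (hb φ hφ) hr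

theorem tendsto_zero_of_dominated {ι : Type*} {l : Filter ι} {g : ι → TD d} {c : ι → ℝ}
    (hc : Tendsto c l (𝓝 0)) (Q : Seminorm ℂ 𝓢(Rn d, ℂ)) (hQ : Continuous Q)
    (h : ∀ᶠ i in l, ∀ φ, ‖g i φ‖ ≤ c i * Q φ) : Tendsto g l (𝓝 0) := by
  rw [tendsto_def]
  intro U hU
  obtain ⟨ε, hε, hεU⟩ := exists_pos_mem_of_dominated hU Q hQ
  filter_upwards [h, hc.eventually_le_const hε] with i h1 h2
  exact hεU _ fun φ => (h1 φ).trans (mul_le_mul_of_nonneg_right h2 (apply_nonneg _ _))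

/-- A family of functionals dominated by a continuous seminorm is bounded in `𝓢'(ℝⁿ)`. -/
theorem exists_bound_of_dominated (Q : Seminorm ℂ 𝓢(Rn d, ℂ)) (hQ : Continuous Q)
    (p : Seminorm ℂ (TD d)) (hp : Continuous p) :
    ∃ C > 0, ∀ T : TD d, (∀ φ, ‖T φ‖ ≤ Q φ) → p T ≤ C := by
  obtain ⟨c, hc, h⟩ := exists_pos_mem_of_dominated (p.ball_mem_nhds hp one_pos) Q hQ
  refine ⟨c⁻¹, inv_pos.2 hc, fun T hT => ?_⟩
  have h1 := h ((c : ℂ) • T) fun φ => by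
    rw [smul_apply, norm_smul, Complex.norm_real, Real.norm_of_nonneg hc.le]
    exact mul_le_mul_of_nonneg_left (hT φ) hc.le
  rw [Seminorm.mem_ball_zero, map_smul_eq_mul, Complex.norm_real, Real.norm_of_nonneg hc.le] at h1
  rw [← one_div, le_div_iff₀' hc]
  exact h1.le

end Strong

/-! ### Smooth functions with values in a topological vector space -/

section Ck

variable {X : Type*} [NormedAddCommGroup X] [NormedSpace ℝ X]
  {V : Type*} [AddCommGroup V] [Module ℝ V] [TopologicalSpace V] {U : Set X}

theorem IsCkOn.of_succ {k : ℕ} {g : X → V} (h : IsCkOn U (k + 1) g) : IsCkOn U k g := by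
  induction k generalizing g with
  | zero => exact h.1
  | succ k ih =>
    refine ⟨h.1, fun v => ?_⟩
    obtain ⟨g', h1, h2⟩ := h.2 v
    exact ⟨g', h1, ih h2⟩

variable [ContinuousAdd V]

theorem IsCkOn.add {k : ℕ} {g h : X → V} (hg : IsCkOn U k g) (hh : IsCkOn U k h) :
    IsCkOn U k (fun x => g x + h x) := by
  induction k generalizing g h with
  | zero => exact ContinuousOn.add hg hh
  | succ k ih =>
    refine ⟨hg.1.add hh.1, fun v => ?_⟩
    obtain ⟨g', g1, g2⟩ := hg.2 v
    obtain ⟨h', h1, h2⟩ := hh.2 v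
    refine ⟨fun x => g' x + h' x, fun x hx => ?_, ih g2 h2⟩
    refine ((g1 x hx).add (h1 x hx)).congr fun t => ?_
    rw [← smul_add]
    exact congrArg (t⁻¹ • ·) (add_sub_add_comm _ _ _ _).symm

theorem tendsto_add_smul (x v : X) : Tendsto (fun t : ℝ => x + t • v) (𝓝[≠] 0) (𝓝 x) := by
  have : Continuous fun t : ℝ => x + t • v := by fun_prop
  have h := this.tendsto 0
  rw [zero_smul, add_zero] at h
  exact h.mono_left nhdsWithin_le_nhds

theorem IsCkOn.sum {ι : Type*} (s : Finset ι) {k : ℕ} {g : ι → X → V}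
    (hz : IsCkOn U k (fun _ => (0 : V))) (hg : ∀ i ∈ s, IsCkOn U k (g i)) :
    IsCkOn U k (fun x => ∑ i ∈ s, g i x) := by
  classical
  induction s using Finset.induction_on with
  | empty => simpa using hz
  | insert a s ha ih =>
    simp only [Finset.sum_insert ha]
    exact (hg a (Finset.mem_insert_self a s)).add
      (ih fun i hi => hg i (Finset.mem_insert_of_mem hi))

variable [ContinuousSMul ℝ V]

theorem IsCkOn.smul {k : ℕ} {c : X → ℝ} {g : X → V} (hU : IsOpen U) (hc : ContDiffOn ℝ ∞ c U)
    (hg : IsCkOn U k g) : IsCkOn U k (fun x => c x • g x) := by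
  induction k generalizing c g with
  | zero => exact ContinuousOn.smul hc.continuousOn hg
  | succ k ih =>
    refine ⟨hc.continuousOn.smul hg.1, fun v => ?_⟩
    obtain ⟨g', g1, g2⟩ := hg.2 v
    have hc' : ContDiffOn ℝ ∞ (fun x => fderiv ℝ c x v) U :=
      (hc.fderiv_of_isOpen hU (m := ∞) (by simp)).clm_apply contDiffOn_const
    -- Leibniz rule. Its first term still contains $g$ itself, of which only one order less of
    -- regularity is needed.
    refine ⟨fun x => fderiv ℝ c x v • g x + c x • g' x, fun x hx => ?_,
      (ih hc' hg.of_succ).add (ih hc g2)⟩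
    have hd : DifferentiableAt ℝ c x :=
      (hc.contDiffAt (hU.mem_nhds hx)).differentiableAt (by simp)
    have h1 : Tendsto (fun t : ℝ => t⁻¹ • (c (x + t • v) - c x)) (𝓝[≠] 0)
        (𝓝 (fderiv ℝ c x v)) := by
      have := (hd.hasFDerivAt.hasLineDerivAt v).tendsto_slope_zero
      simpa using this
    have h2 : Tendsto (fun t : ℝ => g (x + t • v)) (𝓝[≠] 0) (𝓝 (g x)) :=
      (hg.1.continuousAt (hU.mem_nhds hx)).tendsto.comp (tendsto_add_smul x v)
    refine ((h1.smul h2).add ((g1 x hx).const_smul (c x))).congr fun t => ?_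
    rw [smul_comm (c x) t⁻¹, smul_assoc, ← smul_add]
    congr 1
    rw [sub_smul, smul_sub]
    abel

end Ck

/-! ### Smoothness and slow growth of $F$ in the strong topology -/

section Smoothness

variable {d : ℕ}

theorem affineCLM_sub (h h' : Rn d × ℝ) :
    affineCLM (h - h') = affineCLM h - affineCLM h' := by
  ext φ x
  change affineCLM (h - h') φ x = affineCLM h φ x - affineCLM h' φ x
  simp only [affineCLM_apply, Prod.fst_sub, Prod.snd_sub, inner_sub_right]
  push_cast
  ring

theorem affineCLM_smul (t : ℝ) (h : Rn d × ℝ) : affineCLM (t • h) = t • affineCLM h := by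
  ext φ x
  change affineCLM (t • h) φ x = t • affineCLM h φ x
  simp only [affineCLM_apply, Prod.smul_fst, Prod.smul_snd, inner_smul_right, Complex.real_smul,
    smul_eq_mul]
  push_cast
  ring

/-- The functional `φ ↦ f(χ(· · v - b) L φ)`, `p = (v, b)`. -/
def ridgeDual (f : TD d) (χ : 𝓢(ℝ, ℂ)) (L : 𝓢(Rn d, ℂ) →L[ℂ] 𝓢(Rn d, ℂ)) (p : Rn d × ℝ) : TD d :=
  f ∘L ridgeCLM χ p ∘L L

theorem ridgeDual_apply (f : TD d) (χ : 𝓢(ℝ, ℂ)) (L : 𝓢(Rn d, ℂ) →L[ℂ] 𝓢(Rn d, ℂ))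
    (p : Rn d × ℝ) (φ : 𝓢(Rn d, ℂ)) : ridgeDual f χ L p φ = f (ridgeCLM χ p (L φ)) := rfl

instance : ContinuousSMul ℝ (TD d) := IsScalarTower.continuousSMul ℂ

/-- The Lipschitz estimate bounds increments by $\|\gamma(y)-\gamma(x)\|$ times one fixed seminorm,
which forces convergence in the strong dual. -/
theorem continuousOn_ridgeDual {X : Type*} [TopologicalSpace X] {U : Set X}
    (f : TD d) (χ : 𝓢(ℝ, ℂ)) (L : 𝓢(Rn d, ℂ) →L[ℂ] 𝓢(Rn d, ℂ))
    {γ : X → Rn d × ℝ} (hγ : ContinuousOn γ U) (h1 : ∀ x ∈ U, ‖(γ x).1‖ ≤ 1) :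
    ContinuousOn (fun x => ridgeDual f χ L (γ x)) U := by
  intro x hx
  obtain ⟨Q, hQ, h⟩ := dominated_ridgeCLM_lipschitz f χ
  rw [ContinuousWithinAt, ← tendsto_sub_nhds_zero_iff]
  refine tendsto_zero_of_dominated (c := fun y => ‖γ y - γ x‖) ?_ (Q.comp L.toLinearMap)
    (hQ.comp L.continuous) ?_
  · have := ((hγ x hx).sub continuousWithinAt_const).norm (f := fun y => γ y - γ x)
    simpa [ContinuousWithinAt] using this
  · filter_upwards [self_mem_nhdsWithin] with y hy φ
    have := h (γ x) (γ y - γ x) (h1 x hx) (by simpa using h1 y hy) (L φ)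
    rw [add_sub_cancel] at this
    exact this

/-- Along a chart the direction $h$ varies with the base point, whereas the induction on the order
needs fixed operators. The expansion moves the dependence on $h$ into scalar coefficients. -/
theorem ridgeDual_affine (f : TD d) (χ : 𝓢(ℝ, ℂ)) (L : 𝓢(Rn d, ℂ) →L[ℂ] 𝓢(Rn d, ℂ))
    (p h : Rn d × ℝ) : ridgeDual f χ (affineCLM h ∘L L) p =
      ∑ i, h.1 i • ridgeDual f χ (coordCLM i ∘L L) p + (-h.2) • ridgeDual f χ L p := by
  ext φ
  rw [ridgeDual_apply, ContinuousLinearMap.comp_apply, affineCLM_eq]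
  simp only [map_sub, map_sum, map_smul]
  simp [ridgeDual_apply, sub_eq_add_neg]

/-- With $\eta=\gamma(t)-\gamma(0)$, the error splits into $t^{-1}$ times the second-order Taylor
remainder at $\eta$ and the first-order term in the direction $t^{-1}\eta-D$. Both are small
multiples of fixed seminorms. -/
theorem tendsto_ridgeDual (f : TD d) (χ : 𝓢(ℝ, ℂ)) (L : 𝓢(Rn d, ℂ) →L[ℂ] 𝓢(Rn d, ℂ))
    {γ : ℝ → Rn d × ℝ} {D : Rn d × ℝ} (hγ : HasDerivAt γ D 0)
    (h1 : ∀ᶠ t in 𝓝 0, ‖(γ t).1‖ ≤ 1) :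
    Tendsto (fun t : ℝ => t⁻¹ • (ridgeDual f χ L (γ t) - ridgeDual f χ L (γ 0))) (𝓝[≠] 0)
      (𝓝 (ridgeDual f (SchwartzMap.derivCLM ℂ ℂ χ) (affineCLM D ∘L L) (γ 0))) := by
  obtain ⟨Q₁, hQ₁, hT⟩ := dominated_ridgeCLM_taylor f χ
  obtain ⟨Q₀, hQ₀, hB⟩ := dominated_dual_ridgeCLM f (SchwartzMap.derivCLM ℂ ℂ χ) 1
  obtain ⟨Q₂, hQ₂, hA⟩ := dominated_affineCLM Q₀ hQ₀
  have hs : Tendsto (fun t : ℝ => t⁻¹ • (γ t - γ 0)) (𝓝[≠] 0) (𝓝 D) := by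
    simpa using hγ.tendsto_slope_zero
  have hs0 : Tendsto (fun t : ℝ => γ t - γ 0) (𝓝[≠] 0) (𝓝 0) := by
    have := (hγ.continuousAt.tendsto.mono_left (nhdsWithin_le_nhds (s := {0}ᶜ))).sub
      (tendsto_const_nhds (x := γ 0))
    rwa [sub_self] at this
  rw [← tendsto_sub_nhds_zero_iff]
  refine tendsto_zero_of_dominated
    (c := fun t => ‖t⁻¹ • (γ t - γ 0)‖ * ‖γ t - γ 0‖ + ‖t⁻¹ • (γ t - γ 0) - D‖) ?_
    ((Q₁ + Q₂).comp L.toLinearMap) ((hQ₁.add hQ₂).comp L.continuous) ?_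
  · have := (hs.norm.mul hs0.norm).add (hs.sub (tendsto_const_nhds (x := D))).norm
    simpa using this
  · filter_upwards [nhdsWithin_le_nhds h1, self_mem_nhdsWithin] with t ht ht0 φ
    have h0 := h1.self_of_nhds
    have a1 := hT (γ 0) (γ t - γ 0) h0 (by simpa using ht) (L φ)
    rw [add_sub_cancel] at a1
    have a2 := (hB (γ 0) h0 (affineCLM (t⁻¹ • (γ t - γ 0) - D) (L φ))).trans (hA _ _)
    set η := γ t - γ 0
    set χ' := SchwartzMap.derivCLM ℂ ℂ χ
    have e : (t⁻¹ • (ridgeDual f χ L (γ t) - ridgeDual f χ L (γ 0)) -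
        ridgeDual f χ' (affineCLM D ∘L L) (γ 0)) φ =
        t⁻¹ • (f (ridgeCLM χ (γ t) (L φ)) - f (ridgeCLM χ (γ 0) (L φ)) -
          f (ridgeCLM χ' (γ 0) (affineCLM η (L φ)))) +
        f (ridgeCLM χ' (γ 0) (affineCLM (t⁻¹ • η - D) (L φ))) := by
      have e2 : affineCLM (t⁻¹ • η - D) (L φ) =
          ((t⁻¹ : ℝ) : ℂ) • affineCLM η (L φ) - affineCLM D (L φ) := by
        rw [affineCLM_sub, affineCLM_smul]
        rfl
      rw [e2, map_sub, map_sub, map_smul, map_smul]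
      simp only [sub_apply, smul_apply, ridgeDual_apply, ContinuousLinearMap.comp_apply,
        Complex.real_smul, smul_eq_mul]
      ring
    rw [e]
    refine (norm_add_le _ _).trans ?_
    have a3 : ‖t⁻¹ • (f (ridgeCLM χ (γ t) (L φ)) - f (ridgeCLM χ (γ 0) (L φ)) -
          f (ridgeCLM χ' (γ 0) (affineCLM η (L φ))))‖ ≤ ‖t⁻¹ • η‖ * ‖η‖ * Q₁ (L φ) := by
      rw [norm_smul, norm_smul]
      -- One factor $\|\eta\|$ joins $|t|^{-1}$ to form the bounded difference quotient; the other
      -- tends to zero.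
      calc _ ≤ ‖t⁻¹‖ * (‖η‖ ^ 2 * Q₁ (L φ)) := by gcongr
        _ = _ := by ring
    have b1 : 0 ≤ Q₁ (L φ) := apply_nonneg _ _
    have b2 : 0 ≤ Q₂ (L φ) := apply_nonneg _ _
    calc _ ≤ ‖t⁻¹ • η‖ * ‖η‖ * Q₁ (L φ) + ‖t⁻¹ • η - D‖ * Q₂ (L φ) := add_le_add a3 a2
      _ ≤ (‖t⁻¹ • η‖ * ‖η‖ + ‖t⁻¹ • η - D‖) * (Q₁ (L φ) + Q₂ (L φ)) := by
        nlinarith [mul_nonneg (mul_nonneg (norm_nonneg (t⁻¹ • η)) (norm_nonneg η)) b2,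
          mul_nonneg (norm_nonneg (t⁻¹ • η - D)) b1]

variable {X : Type*} [NormedAddCommGroup X] [NormedSpace ℝ X] {U : Set X}

theorem isCkOn_zero (k : ℕ) : IsCkOn U k (fun _ : X => (0 : TD d)) := by
  induction k with
  | zero => exact continuousOn_const
  | succ k ih => exact ⟨continuousOn_const, fun v => ⟨fun _ => 0, fun x _ => by simp, ih⟩⟩

/-- Smoothness of `(v, b) ↦ (φ ↦ f(χ(· · v - b) L φ))` along smooth maps into
the set `|v| ≤ 1`. -/
theorem isCkOn_ridgeDual (f : TD d) (χ : 𝓢(ℝ, ℂ)) (L : 𝓢(Rn d, ℂ) →L[ℂ] 𝓢(Rn d, ℂ))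
    {γ : X → Rn d × ℝ} (hU : IsOpen U) (hγ : ContDiffOn ℝ ∞ γ U) (h1 : ∀ x ∈ U, ‖(γ x).1‖ ≤ 1)
    (k : ℕ) : IsCkOn U k (fun x => ridgeDual f χ L (γ x)) := by
  induction k generalizing χ L with
  | zero => exact continuousOn_ridgeDual f χ L hγ.continuousOn h1
  | succ k ih =>
    refine ⟨continuousOn_ridgeDual f χ L hγ.continuousOn h1, fun v => ?_⟩
    refine ⟨fun x => ridgeDual f (SchwartzMap.derivCLM ℂ ℂ χ)
      (affineCLM (fderiv ℝ γ x v) ∘L L) (γ x), fun x hx => ?_, ?_⟩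
    · have hd : DifferentiableAt ℝ γ x :=
        (hγ.contDiffAt (hU.mem_nhds hx)).differentiableAt (by simp)
      have hl : HasDerivAt (fun t : ℝ => γ (x + t • v)) (fderiv ℝ γ x v) 0 :=
        hd.hasFDerivAt.hasLineDerivAt v
      have hc : Tendsto (fun t : ℝ => x + t • v) (𝓝 0) (𝓝 x) := by
        have : Continuous fun t : ℝ => x + t • v := by fun_prop
        simpa using this.tendsto 0
      have := tendsto_ridgeDual f χ L hl ((hc.eventually (hU.mem_nhds hx)).mono fun t ht => h1 _ ht)
      simpa using this
    · simp only [ridgeDual_affine]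
      have hD : ContDiffOn ℝ ∞ (fun x => fderiv ℝ γ x v) U :=
        (hγ.fderiv_of_isOpen hU (m := ∞) (by simp)).clm_apply contDiffOn_const
      refine (IsCkOn.sum _ (isCkOn_zero k) fun i _ => ?_).add ?_
      · exact IsCkOn.smul hU (((EuclideanSpace.proj i : Rn d →L[ℝ] ℝ).contDiff).comp_contDiffOn
          hD.fst) (ih _ _)
      · exact IsCkOn.smul hU hD.snd.neg (ih _ _)

/-- The complex conjugate of a Schwartz function on the line. -/
def conjSchwartz (ψ : 𝓢(ℝ, ℂ)) : 𝓢(ℝ, ℂ) :=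
  SchwartzMap.postcompCLM (𝕜 := ℝ) Complex.conjCLE.toContinuousLinearMap ψ

/-- In a chart, $F$ is by definition a `ridgeDual` with $L=\mathcal F_\alpha$ and
$\chi=\overline\psi$, where $\gamma$ is the inverse chart followed by the inclusion of the sphere in
$\mathbb R^n$. -/
theorem isSmooth_dsFun (α : Fin (d + 1) → ℝ) (hα : ∀ k, Real.sin (α k) ≠ 0) (ψ : 𝓢(ℝ, ℂ))
    (f : TD d) : IsSmooth ((𝓡 d).prod 𝓘(ℝ, ℝ)) (dsFun α hα ψ f) := by
  intro p k
  have := Fact.mk (@finrank_euclideanSpace_fin ℝ _ (d + 1))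
  refine isCkOn_ridgeDual f (conjSchwartz ψ) (frft α hα)
    (γ := fun y => ((((extChartAt ((𝓡 d).prod 𝓘(ℝ, ℝ)) p).symm y).1 : Rn d),
      ((extChartAt ((𝓡 d).prod 𝓘(ℝ, ℝ)) p).symm y).2))
    (isOpen_extChartAt_target p) ?_ (fun y _ => by simp) k
  have h1 : ContMDiffOn 𝓘(ℝ, EuclideanSpace ℝ (Fin d) × ℝ) ((𝓡 d).prod 𝓘(ℝ, ℝ)) ∞
      (extChartAt ((𝓡 d).prod 𝓘(ℝ, ℝ)) p).symm (extChartAt ((𝓡 d).prod 𝓘(ℝ, ℝ)) p).target :=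
    contMDiffOn_extChartAt_symm p
  have hc : ContMDiff (𝓡 d) 𝓘(ℝ, Rn d) ∞ ((↑) : Sph d → Rn d) := contMDiff_coe_sphere
  have h2 : ContMDiff ((𝓡 d).prod 𝓘(ℝ, ℝ)) 𝓘(ℝ, Rn d × ℝ) ∞
      (fun q : Sph d × ℝ => ((q.1 : Rn d), q.2)) :=
    (hc.comp contMDiff_fst).prodMk_space contMDiff_snd
  exact contMDiffOn_iff_contDiffOn.1 (h2.comp_contMDiffOn h1)

/-- The functionals `F(u, b)` are dominated by a continuous seminorm. -/
theorem dominated_dsFun (α : Fin (d + 1) → ℝ) (hα : ∀ k, Real.sin (α k) ≠ 0) (ψ : 𝓢(ℝ, ℂ))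
    (f : TD d) : ∃ Q : Seminorm ℂ 𝓢(Rn d, ℂ), Continuous Q ∧ ∀ p φ,
      ‖dsFun α hα ψ f p φ‖ ≤ Q φ := by
  obtain ⟨Q, hQ, h⟩ := dominated_dual_ridgeCLM f (conjSchwartz ψ) 1
  refine ⟨Q.comp (frft α hα).toLinearMap, hQ.comp (frft α hα).continuous, fun p φ => ?_⟩
  exact h ((p.1 : Rn d), p.2) (by simp) (frft α hα φ)

theorem slowGrowth_dsFun (α : Fin (d + 1) → ℝ) (hα : ∀ k, Real.sin (α k) ≠ 0) (ψ : 𝓢(ℝ, ℂ))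
    (f : TD d) : SlowGrowth (dsFun α hα ψ f) := by
  obtain ⟨Q, hQ, h⟩ := dominated_dsFun α hα ψ f
  -- The dominating seminorm does not depend on $(u,b)$, so $F$ is even bounded and no power of
  -- $1+|b|$ is needed.
  refine ⟨0, fun p hp => ?_⟩
  obtain ⟨C, hC, hb⟩ := exists_bound_of_dominated Q hQ p hp
  exact ⟨C, hC, fun u b => by simpa using hb _ (h (u, b))⟩

end Smoothness

/-! ### The kernel -/

section Kernel

theorem conj_fracConst_neg (θ : ℝ) : conj (fracConst (-θ)) = fracConst θ := by
  have hc : Real.cot (-θ) = -Real.cot θ := by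
    simp [Real.cot_eq_cos_div_sin, div_neg]
  have e : (2 * Real.pi : ℂ) = ((2 * Real.pi : ℝ) : ℂ) := by push_cast; rfl
  rw [fracConst, fracConst, hc, e]
  generalize Real.cot θ = c
  have hz : (1 - Complex.I * (c : ℂ)) / ((2 * Real.pi : ℝ) : ℂ) =
      conj ((1 - Complex.I * ((-c : ℝ) : ℂ)) / ((2 * Real.pi : ℝ) : ℂ)) := by
    rw [map_div₀, map_sub, map_mul, map_one, Complex.conj_I, Complex.conj_ofReal,
      Complex.conj_ofReal, Complex.ofReal_neg, neg_mul_neg]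
  -- The principal root commutes with conjugation off the negative real axis; here the real part is
  -- $1/(2\pi)$.
  have harg : ((1 - Complex.I * ((-c : ℝ) : ℂ)) / ((2 * Real.pi : ℝ) : ℂ)).arg ≠ Real.pi := by
    rw [Ne, Complex.arg_eq_pi_iff]
    rintro ⟨h, -⟩
    rw [Complex.div_ofReal_re] at h
    exact h.not_ge (div_nonneg (by simp) Real.two_pi_pos.le)
  rw [hz, Complex.conj_cpow _ _ harg]
  congr 2
  rw [map_div₀, map_one, map_ofNat]

theorem conj_fracKernel₁_neg (θ x ξ : ℝ) : conj (fracKernel₁ (-θ) x ξ) = fracKernel₁ θ ξ x := by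
  have hc : Real.cot (-θ) = -Real.cot θ := by
    simp [Real.cot_eq_cos_div_sin, div_neg]
  rw [fracKernel₁, fracKernel₁, map_mul, conj_fracConst_neg, ← Complex.exp_conj, map_mul,
    Complex.conj_I, Complex.conj_ofReal, hc, Real.sin_neg]
  congr 2
  push_cast
  rw [inv_neg]
  ring

/-- The exchange of the two arguments puts $a$ in the integration slot, so that the conjugated
synthesis integral contains $\mathcal F_\alpha$ of the slices. -/
theorem conj_fracKernel_neg {d : ℕ} (α : Fin (d + 1) → ℝ) (x ξ : Rn d) :
    conj (fracKernel (-α) x ξ) = fracKernel α ξ x := by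
  simp only [fracKernel, map_prod, Pi.neg_apply, conj_fracKernel₁_neg]

theorem norm_fracKernel {d : ℕ} (α : Fin (d + 1) → ℝ) (x ξ : Rn d) :
    ‖fracKernel α x ξ‖ = ∏ k, ‖fracConst (α k)‖ := by
  rw [fracKernel, norm_prod]
  refine Finset.prod_congr rfl fun k _ => ?_
  rw [fracKernel₁, norm_mul, mul_comm Complex.I, Complex.norm_exp_ofReal_mul_I, mul_one]

theorem continuous_fracKernel_left {d : ℕ} (α : Fin (d + 1) → ℝ) (ξ : Rn d) :
    Continuous fun x : Rn d => fracKernel α x ξ := by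
  unfold fracKernel fracKernel₁
  fun_prop

end Kernel

/-! ### Slices of functions in `𝓢(𝕐²ⁿ)` -/

section Slice

variable {d : ℕ}

theorem weight_two (k : ℕ) (y : Y d) :
    weight 2 k y = (1 + y.2.1 ^ 2) * (1 + ‖y.2.2‖ ^ 2) ^ ((k : ℝ) / 2) := by
  simp [weight]

theorem weight_mul_norm_diffY_le (Φ : SchwartzY d) (r s k m l : ℕ) (y : Y d) :
    weight r s y * ‖diffY k m l Φ y‖ ≤ seminormY d (r, s, k, m, l) Φ :=
  le_ciSup (Φ.2.2 r s k m l) y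

/-- The weight exponent $r=2$ in $b$ gives the factor $(1+b^2)^{-1}$, which is integrable on
$\mathbb S^{n-1}\times\mathbb R$. No derivatives in $u$ or $b$ are involved. -/
theorem seminorm_slice_le (Φ : SchwartzY d) (u : Sph d) (b : ℝ) (k l : ℕ) :
    SchwartzMap.seminorm ℝ k l (Φ.slice u b) ≤
      (1 + b ^ 2)⁻¹ * seminormY d (2, k, 0, 0, l) Φ := by
  refine SchwartzMap.seminorm_le_bound ℝ k l _
    (mul_nonneg (by positivity) (apply_nonneg _ _)) fun a => ?_
  have h := weight_mul_norm_diffY_le Φ 2 k 0 0 l (u, b, a)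
  rw [weight_two] at h
  have e : diffY 0 0 l Φ (u, b, a) = iteratedFDeriv ℝ l (Φ.slice u b) a := by
    simp only [diffY, Function.iterate_zero, id_eq, iteratedDeriv_zero]
    rfl
  rw [e] at h
  rw [inv_mul_eq_div, le_div_iff₀ (by positivity)]
  refine le_trans ?_ h
  have h2 : ‖a‖ ^ k ≤ (1 + ‖a‖ ^ 2) ^ ((k : ℝ) / 2) := by
    have h : ‖a‖ ^ k = (‖a‖ ^ 2) ^ ((k : ℝ) / 2) := by
      rw [← Real.rpow_natCast ‖a‖ 2, ← Real.rpow_mul (norm_nonneg a), ← Real.rpow_natCast]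
      congr 1
      push_cast
      ring
    rw [h]
    exact Real.rpow_le_rpow (by positivity) (by linarith) (by positivity)
  calc _ = (1 + b ^ 2) * ‖a‖ ^ k * ‖iteratedFDeriv ℝ l (Φ.slice u b) a‖ := by ring
    _ ≤ _ := by gcongr

/-- The radial extension makes $\Phi$ a smooth function on an open subset of a vector space, so its
$a$-derivatives are jointly continuous; the seminorm bounds are global. -/
theorem continuous_slice (Φ : SchwartzY d) :
    Continuous fun p : Sph d × ℝ => Φ.slice p.1 p.2 := by
  refine continuous_of_continuous_iteratedFDeriv (fun l => ?_) fun k l p₀ => ?_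
  · have hsm : ∀ q : (Rn d × ℝ) × Rn d, q.1 ∈ {p : Rn d × ℝ | p.1 ≠ 0} → ContDiffAt ℝ ∞
        (fun q : (Rn d × ℝ) × Rn d => radialExt (fun u => Φ (u, q.1.2, q.2)) q.1.1) q :=
      fun q hq => (Φ.2.1.contDiffAt q.1.1 hq (q.1.2, q.2)).comp
        (f := fun q : (Rn d × ℝ) × Rn d => (q.1.1, q.1.2, q.2)) q (by fun_prop)
    rw [continuous_iff_continuousAt]
    rintro ⟨⟨u, b⟩, a⟩
    have h1 := (contDiffAt_iteratedFDeriv_snd hsm l (((u : Rn d), b), a)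
      (ne_zero_of_mem_unit_sphere u)).continuousAt
    have h2 : ContinuousAt (fun q : (Sph d × ℝ) × Rn d => (((q.1.1 : Rn d), q.1.2), q.2))
        ((u, b), a) := by fun_prop
    refine (ContinuousAt.comp (f := fun q : (Sph d × ℝ) × Rn d => (((q.1.1 : Rn d), q.1.2), q.2))
      (x := ((u, b), a)) h1 h2).congr (Eventually.of_forall fun q => ?_)
    simp only [Function.comp_apply]
    congr 1
    funext x
    exact radialExt_coe (fun u => Φ (u, q.1.2, x)) q.1.1
  · refine ⟨seminormY d (2, k, 0, 0, l) Φ, Eventually.of_forall fun p => ?_⟩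
    refine (seminorm_slice_le Φ p.1 p.2 k l).trans ?_
    refine mul_le_of_le_one_left (apply_nonneg _ _) (inv_le_one_of_one_le₀ ?_)
    nlinarith [sq_nonneg p.2]

theorem dominated_slice (Q : Seminorm ℂ 𝓢(Rn d, ℂ)) (hQ : Continuous Q) :
    ∃ R : Seminorm ℂ (SchwartzY d), Continuous R ∧ ∀ Φ u b,
      Q (Φ.slice u b) ≤ (1 + b ^ 2)⁻¹ * R Φ := by
  obtain ⟨s, C, hC, h⟩ := exists_bound_of_continuous_seminorm Q hQ
  obtain ⟨R, hR, h'⟩ : Dominated (V := SchwartzY d)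
      fun Φ => C * ∑ i ∈ s, seminormY d (2, i.1, 0, 0, i.2) Φ :=
    (Dominated.sum s fun i _ => Dominated.of_continuous _
      ((withSeminormsY d).continuous_seminorm (2, i.1, 0, 0, i.2))).const_mul hC
  refine ⟨R, hR, fun Φ u b => (h _).trans ?_⟩
  calc _ ≤ C * ∑ i ∈ s, (1 + b ^ 2)⁻¹ * seminormY d (2, i.1, 0, 0, i.2) Φ := by
        gcongr with i _
        exact seminorm_slice_le Φ u b i.1 i.2
    _ = (1 + b ^ 2)⁻¹ * (C * ∑ i ∈ s, seminormY d (2, i.1, 0, 0, i.2) Φ) := by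
        rw [← Finset.mul_sum]; ring
    _ ≤ _ := mul_le_mul_of_nonneg_left (h' Φ) (by positivity)

theorem integrable_inv_one_add_sq_snd :
    Integrable (fun p : Sph d × ℝ => (1 + p.2 ^ 2)⁻¹) ((sphereMeasure d).prod volume) :=
  integrable_inv_one_add_sq.comp_snd (sphereMeasure d)

theorem integrable_slice_prod (Φ : SchwartzY d) (u : Sph d) :
    Integrable (fun z : ℝ × Rn d => Φ (u, z.1, z.2)) := by
  -- The least integer above the dimension $d+1$, so that $(1+|a|^2)^{-N/2}$ is integrable.
  set N : ℕ := d + 2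
  have h1 : Integrable (fun a : Rn d => ((1 : ℝ) + ‖a‖ ^ 2) ^ (-(N : ℝ) / 2)) :=
    integrable_rpow_neg_one_add_norm_sq (by
      rw [finrank_euclideanSpace_fin]
      exact_mod_cast Nat.lt_succ_self (d + 1))
  have h2 : Integrable (fun z : ℝ × Rn d => (1 + z.1 ^ 2)⁻¹ *
      ((1 : ℝ) + ‖z.2‖ ^ 2) ^ (-(N : ℝ) / 2)) := integrable_inv_one_add_sq.mul_prod h1
  refine (h2.const_mul (seminormY d (2, N, 0, 0, 0) Φ)).mono'
    (Φ.2.1.contDiff_slice u).continuous.aestronglyMeasurable (Eventually.of_forall fun z => ?_)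
  have h := weight_mul_norm_diffY_le Φ 2 N 0 0 0 (u, z)
  rw [weight_two] at h
  have e : ‖diffY 0 0 0 Φ (u, z)‖ = ‖Φ (u, z.1, z.2)‖ := by
    simp [diffY]
  rw [e] at h
  have h3 : (0 : ℝ) < 1 + z.1 ^ 2 := by positivity
  have h4 : (0 : ℝ) < (1 + ‖z.2‖ ^ 2) ^ ((N : ℝ) / 2) := by positivity
  rw [neg_div, Real.rpow_neg (by positivity), ← mul_inv, ← div_eq_mul_inv,
    le_div_iff₀ (mul_pos h3 h4), mul_comm]
  exact h

end Slice

/-! ### The directional short-time fractional Fourier transform -/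

section Transform

variable {d : ℕ} (α : Fin (d + 1) → ℝ) (hα : ∀ k, Real.sin (α k) ≠ 0) (ψ : 𝓢(ℝ, ℂ))

/-- The family of Schwartz functions `x ↦ ψ̄(x · u - b) 𝓕_α(Φ(u, b, ·))(x)`. -/
def synthFamily (Φ : SchwartzY d) (p : Sph d × ℝ) : 𝓢(Rn d, ℂ) :=
  ridgeCLM (conjSchwartz ψ) ((p.1 : Rn d), p.2) (frft α hα (Φ.slice p.1 p.2))

theorem continuous_synthFamily (Φ : SchwartzY d) : Continuous (synthFamily α hα ψ Φ) :=
  continuous_ridgeCLM_family _ (by fun_prop) ((frft α hα).continuous.comp (continuous_slice Φ))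

theorem integrable_seminorm_synthFamily (Φ : SchwartzY d) (k l : ℕ) :
    Integrable (fun p => SchwartzMap.seminorm ℝ k l (synthFamily α hα ψ Φ p))
      ((sphereMeasure d).prod volume) := by
  obtain ⟨Q, hQ, h⟩ := dominated_seminorm_ridgeCLM (d := d) (conjSchwartz ψ) 1 k l
  obtain ⟨R, -, hR⟩ := dominated_slice (Q.comp (frft α hα).toLinearMap)
    (hQ.comp (frft α hα).continuous)
  refine (integrable_inv_one_add_sq_snd.mul_const (R Φ)).mono'
    (continuous_seminorm_comp (continuous_synthFamily α hα ψ Φ) k l).aestronglyMeasurable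
    (Eventually.of_forall fun p => ?_)
  rw [Real.norm_of_nonneg (apply_nonneg _ _)]
  exact (h ((p.1 : Rn d), p.2) (by simp) _).trans (hR Φ p.1 p.2)

/-- The Schwartz function `conj ((DS_ψ^α)^* (conj Φ))`. -/
def synth (Φ : SchwartzY d) : 𝓢(Rn d, ℂ) :=
  integralFamily (continuous_synthFamily α hα ψ Φ) (integrable_seminorm_synthFamily α hα ψ Φ)

/-- The family is integrated over $(u,b)$ with the $a$-integral hidden inside $\mathcal F_\alpha$,
while the synthesis operator integrates in $b$ first. Fubini on $\mathbb R\times\mathbb R^n$ for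
fixed $u$ reconciles the two orders. -/
theorem synth_apply (Φ : SchwartzY d) (x : Rn d) :
    synth α hα ψ Φ x = conj (dsSynth α ψ (fun y => conj (Φ y)) x) := by
  have h1 : synth α hα ψ Φ x =
      ∫ p, synthFamily α hα ψ Φ p x ∂((sphereMeasure d).prod volume) := rfl
  rw [h1, integral_prod _ (integrable_apply_family (continuous_synthFamily α hα ψ Φ)
    (integrable_seminorm_synthFamily α hα ψ Φ) x), dsSynth, ← integral_conj]
  refine integral_congr_ae (Eventually.of_forall fun u => ?_)
  simp only [← integral_conj, map_mul, Complex.conj_conj, conj_fracKernel_neg]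
  have hint : Integrable (fun z : ℝ × Rn d =>
      Φ (u, z.1, z.2) * conj (ψ (⟪x, (u : Rn d)⟫_ℝ - z.1)) * fracKernel α z.2 x) := by
    have hb : ∀ z : ℝ × Rn d,
        ‖conj (ψ (⟪x, (u : Rn d)⟫_ℝ - z.1)) * fracKernel α z.2 x‖ ≤
          SchwartzMap.seminorm ℝ 0 0 ψ * ∏ k, ‖fracConst (α k)‖ := fun z => by
      rw [norm_mul, norm_fracKernel, RCLike.norm_conj]
      exact mul_le_mul_of_nonneg_right (SchwartzMap.norm_le_seminorm ℝ ψ _)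
        (Finset.prod_nonneg fun _ _ => norm_nonneg _)
    have hc : Continuous fun z : ℝ × Rn d =>
        conj (ψ (⟪x, (u : Rn d)⟫_ℝ - z.1)) * fracKernel α z.2 x :=
      (Complex.continuous_conj.comp (ψ.continuous.comp (by fun_prop))).mul
        ((continuous_fracKernel_left α x).comp continuous_snd)
    have := (integrable_slice_prod Φ u).mul_bdd (c := SchwartzMap.seminorm ℝ 0 0 ψ *
      ∏ k, ‖fracConst (α k)‖) hc.aestronglyMeasurable (Eventually.of_forall hb)
    simpa only [mul_assoc] using this
  rw [← integral_integral_swap hint]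
  refine integral_congr_ae (Eventually.of_forall fun b => ?_)
  simp only [synthFamily, ridgeCLM_apply, frft_apply]
  rw [← integral_const_mul]
  refine integral_congr_ae (Eventually.of_forall fun a => ?_)
  change conj (ψ (⟪x, (u : Rn d)⟫_ℝ - b)) * (Φ (u, b, a) * fracKernel α a x) = _
  ring

variable (f : TD d)

/-- By unfolding, $\langle F(p),\Phi(p,\cdot)\rangle$ is $f$ applied to `synthFamily`, whose
seminorms are integrable. -/
theorem integrable_dsFun_slice (Φ : SchwartzY d) :
    Integrable (fun p : Sph d × ℝ => dsFun α hα ψ f p (Φ.slice p.1 p.2))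
      ((sphereMeasure d).prod volume) :=
  integrable_dual_family (continuous_synthFamily α hα ψ Φ)
    (integrable_seminorm_synthFamily α hα ψ Φ) f

/-- The directional short-time fractional Fourier transform of a tempered distribution as a linear
functional. -/
def dsLinear : SchwartzY d →ₗ[ℂ] ℂ where
  toFun Φ := ∫ p, dsFun α hα ψ f p (Φ.slice p.1 p.2) ∂((sphereMeasure d).prod volume)
  map_add' Φ Ψ := by
    rw [← integral_add (integrable_dsFun_slice α hα ψ f Φ) (integrable_dsFun_slice α hα ψ f Ψ)]
    refine integral_congr_ae (Eventually.of_forall fun p => ?_)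
    exact map_add (dsFun α hα ψ f p) (Φ.slice p.1 p.2) (Ψ.slice p.1 p.2)
  map_smul' c Φ := by
    rw [RingHom.id_apply, ← integral_smul]
    refine integral_congr_ae (Eventually.of_forall fun p => ?_)
    exact map_smul (dsFun α hα ψ f p) c (Φ.slice p.1 p.2)

/-- One seminorm dominates all $F(u,b)$, and on slices it is at most $(1+b^2)^{-1}R(\Phi)$;
integration gives the bound $K\,R(\Phi)$. -/
theorem continuous_dsLinear : Continuous (dsLinear α hα ψ f) := by
  have : IsTopologicalAddGroup (SchwartzY d) := (withSeminormsY d).topologicalAddGroup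
  obtain ⟨Q, hQ, h⟩ := dominated_dsFun α hα ψ f
  obtain ⟨R, hR, h'⟩ := dominated_slice Q hQ
  set K := ∫ p : Sph d × ℝ, (1 + p.2 ^ 2)⁻¹ ∂((sphereMeasure d).prod volume)
  have hb : ∀ Φ, ‖dsLinear α hα ψ f Φ‖ ≤ K * R Φ := fun Φ => by
    rw [← integral_mul_const]
    exact norm_integral_le_of_norm_le (integrable_inv_one_add_sq_snd.mul_const (R Φ))
      (Eventually.of_forall fun p => (h p _).trans (h' Φ p.1 p.2))
  refine continuous_of_continuousAt_zero (dsLinear α hα ψ f) ?_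
  rw [ContinuousAt, map_zero]
  refine squeeze_zero_norm hb ?_
  have h0 := (hR.tendsto 0).const_mul K
  rwa [map_zero, mul_zero] at h0

/-- The directional short-time fractional Fourier transform of a tempered distribution. -/
def dsTransform : TDY d := ⟨dsLinear α hα ψ f, continuous_dsLinear α hα ψ f⟩

/-- The functional was built from the integral formula; that it agrees with the definition by
duality is exactly the interchange of $f$ with the integral. -/
theorem isDS_dsTransform : IsDS α ψ f (dsTransform α hα ψ f) := fun Φ =>
  ⟨synth α hα ψ Φ, synth_apply α hα ψ Φ,
    (dual_integralFamily (continuous_synthFamily α hα ψ Φ)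
      (integrable_seminorm_synthFamily α hα ψ Φ) f).symm⟩

theorem isGivenBy_dsTransform : IsGivenBy (dsTransform α hα ψ f) (dsFun α hα ψ f) := fun Φ =>
  ⟨integrable_dsFun_slice α hα ψ f Φ, integral_prod _ (integrable_dsFun_slice α hα ψ f Φ)⟩

end Transform

end DSTFRFT

end

theorem proposition6p1 (d : ℕ) (hd : 1 ≤ d) (α : Fin (d + 1) → ℝ)
    (hα : ∀ k, α k ∈ Ioo (-Real.pi) Real.pi \ {0})
    (f : StrongDual ℂ (𝓢(DSTFRFT.Rn d, ℂ))) (ψ : 𝓢(ℝ, ℂ)) :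
    ∃ T : DSTFRFT.TDY d,
      DSTFRFT.IsDS α ψ f T ∧
      DSTFRFT.IsGivenBy T (DSTFRFT.dsFun α (DSTFRFT.sin_ne_zero_of_mem hα) ψ f) ∧
      DSTFRFT.IsSmooth ((𝓡 d).prod 𝓘(ℝ, ℝ))
        (DSTFRFT.dsFun α (DSTFRFT.sin_ne_zero_of_mem hα) ψ f) ∧
      DSTFRFT.SlowGrowth (DSTFRFT.dsFun α (DSTFRFT.sin_ne_zero_of_mem hα) ψ f) :=
  ⟨DSTFRFT.dsTransform α (DSTFRFT.sin_ne_zero_of_mem hα) ψ f,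
    DSTFRFT.isDS_dsTransform α _ ψ f, DSTFRFT.isGivenBy_dsTransform α _ ψ f,
    DSTFRFT.isSmooth_dsFun α _ ψ f, DSTFRFT.slowGrowth_dsFun α _ ψ f⟩
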